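/- Let $d\ge 2$, let $\mathcal H_0\simeq\mathcal H_1\simeq\mathcal H_2\simeq\mathcal H_3\simeq\mathbb C^d$ with a fixed orthonormal basis, let $dU$ be the normalized Haar measure of $SU(d)$, and write $|A\rangle\rangle=\sum_{n,m}\langle n|A|m\rangle\,|n\rangle|m\rangle$ (so $|U\rangle\rangle\langle\langle U|$ is the Choi operator of the channel $\rho\mapsto U\rho U^\dagger$). Stars on operators denote entrywise complex conjugation. A deterministic comb is an operator $R\ge 0$ on $\mathcal H_3\otimes\mathcal H_2\otimes\mathcal H_1\otimes\mathcal H_0$ with $\mathrm{Tr}_3R=I_2\otimes R^{(1)}$ for some $R^{(1)}\ge 0$ with $\mathrm{Tr}_1R^{(1)}=I_0$. A generalized 2-instrument (with outcomes in $SU(d)$) is a Haar-integrable family $\{R_{\hat U}\}_{\hat U\in SU(d)}$ of positive operators on $\mathcal H_3\otimes\mathcal H_2\otimes\mathcal H_1\otimes\mathcal H_0$ (an operator density) such that $\int d\hat U\,R_{\hat U}$ is a deterministic comb. Inserting the black box $U\in SU(d)$ between wires $1$ and $2$ gives the operations from $\mathcal H_0$ to $\mathcal H_3$ with Choi operators $$C_{\hat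 U,U}=\mathrm{Tr}_{2,1}\big[R_{\hat U}\,(I_3\otimes(|U\rangle\rangle\langle\langle U|_{2,1})^{T}\otimes I_0)\big].$$ For the input state $I/d$ the outcome density is $p(\hat U|U)=\frac1d\mathrm{Tr}[C_{\hat U,U}]$. Define the average information gain and the average channel fidelity by $$G=\int dU\int d\hat U\;p(\hat U|U)\,\frac{|\mathrm{Tr}[\hat UU^\dagger]|^2}{d^2},\qquad F=\frac1{d^2}\int dU\int d\hat U\;\langle\langle U|C_{\hat U,U}|U\rangle\rangle ,$$ and the information and the disturbance by $$I=\frac{G-1/d^2}{2/d^2-1/d^2},\qquad D=\frac{1-F}{1-2/d^2}.$$ For real $x,y\ge 0$ with $x^2+y^2+2xy/d=1$ ("admissible" $x,y$) put $$R^{x,y}_{\hat U}=|\chi_{\hat U}\rangle\langle\chi_{\hat U}|,\qquad |\chi_{\hat U}\rangle=x\,|\hat U\rangle\rangle_{3,0}|\hat U^*\rangle\rangle_{2,1}+y\,|I\rangle\rangle_{3,2}|I\rangle\rangle_{1,0}.$$ Then: 1. For every $p\in[0,1]$ there are admissible $x,y$ such that $\{R^{x,y}_{\hat U}\}$ is a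 generalized 2-instrument that maximizes $pG+(1-p)F$ over all generalized 2-instruments. 2. For all admissible $x,y$, $\{R^{x,y}_{\hat U}\}$ is a generalized 2-instrument, it maximizes $pG+(1-p)F$ over all generalized 2-instruments for some $p\in[0,1]$, and it has $$F=1-\frac{d^2-2}{d^2}x^2,\qquad G=\frac{2-y^2}{d^2},\qquad x=\sqrt D,\qquad y=\sqrt{1-I},\qquad d^2(D-I)^2-4D(1-I)=0.$$ 3. (Optimal trade-off curve.) For $I\in[0,1]$, a real number $D$ is the minimum disturbance of the generalized 2-instruments with information $I$ (the minimum being attained) if and only if $D\le I$ and $d^2(D-I)^2-4D(1-I)=0$. For $D\in[0,1]$, a real number $I$ is the maximum information of the generalized 2-instruments with disturbance $D$ (the maximum being attained) if and only if $D\le I$ and $d^2(D-I)^2-4D(1-I)=0$. -/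

import Mathlib

open MeasureTheory
open scoped Kronecker ComplexOrder

noncomputable section

namespace QTradeoff

/-! ### The group `SU(d)` and its normalized Haar measure -/

/-- The special unitary group `SU(d)`. -/
abbrev SU (d : ℕ) : Type := Matrix.specialUnitaryGroup (Fin d) ℂ

instance instIsTopologicalGroupSU (d : ℕ) : IsTopologicalGroup (SU d) where
  continuous_mul := continuous_mul
  continuous_inv := by
    have h : Continuous fun U : SU d => star (U : Matrix (Fin d) (Fin d) ℂ) :=
      continuous_star.comp continuous_subtype_val
    exact h.subtype_mk fun U => (star U).2

instance instCompactSpaceSU (d : ℕ) : CompactSpace (SU d) := by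
  apply isCompact_iff_compactSpace.mp
  have hK : IsCompact (Set.univ.pi fun _ : Fin d => Set.univ.pi fun _ : Fin d =>
      Metric.closedBall (0 : ℂ) 1) :=
    isCompact_univ_pi fun _ => isCompact_univ_pi fun _ => isCompact_closedBall 0 1
  have hcl : IsClosed {U : Matrix (Fin d) (Fin d) ℂ | star U * U = 1 ∧ U.det = 1} := by
    apply IsClosed.inter
    · exact isClosed_eq (continuous_star.mul continuous_id) continuous_const
    · exact isClosed_eq continuous_id.matrix_det continuous_const
  refine IsCompact.of_isClosed_subset hK ?_ ?_
  · convert hcl using 1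
    ext U
    exact Matrix.mem_specialUnitaryGroup_iff.trans
      (and_congr_left fun _ => Matrix.mem_unitaryGroup_iff')
  · intro U hU i _ j _
    have := entry_norm_bound_of_unitary (Matrix.mem_specialUnitaryGroup_iff.mp hU).1 i j
    simpa using this

instance instMeasurableSpaceSU (d : ℕ) : MeasurableSpace (SU d) := borel _

instance instBorelSpaceSU (d : ℕ) : BorelSpace (SU d) := ⟨rfl⟩

/-- The Haar measure `dU` of `SU(d)`, normalized to total mass one. -/
def haarSU (d : ℕ) : Measure (SU d) := Measure.haarMeasure ⊤

instance instIsProbabilityMeasureHaarSU (d : ℕ) : IsProbabilityMeasure (haarSU d) :=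
  ⟨by simpa [haarSU] using
    Measure.haarMeasure_self (K₀ := (⊤ : TopologicalSpace.PositiveCompacts (SU d)))⟩

/-! ### Choi operators and quantum combs

Every wire carries `ℂ^d` with its standard basis, indexed by `Fin d`.  Operators on
`H₃ ⊗ H₂ ⊗ H₁ ⊗ H₀` are matrices indexed by `Wires d`, the coordinates being listed in the
order `(3, 2, 1, 0)`. -/

/-- Basis of `H₃ ⊗ (H₂ ⊗ (H₁ ⊗ H₀))`. -/
abbrev Wires (d : ℕ) : Type := Fin d × Fin d × Fin d × Fin d

/-- The vector `|A⟩⟩ = ∑ₙₘ ⟨n|A|m⟩ |n⟩|m⟩`. -/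
def dket {d : ℕ} (A : Matrix (Fin d) (Fin d) ℂ) : Fin d × Fin d → ℂ := fun a => A a.1 a.2

/-- Choi operator `(T ⊗ id)(|I⟩⟩⟨⟨I|) = ∑ₙₘ T(|n⟩⟨m|) ⊗ |n⟩⟨m|`; the output wire comes first. -/
def choi {d : ℕ} (T : Matrix (Fin d) (Fin d) ℂ → Matrix (Fin d) (Fin d) ℂ) :
    Matrix (Fin d × Fin d) (Fin d × Fin d) ℂ :=
  Matrix.of fun a b => T (Matrix.single a.2 b.2 1) a.1 b.1

/-- The unitary channel `ρ ↦ U ρ U†`. -/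
def unitaryChannel {d : ℕ} (U : SU d) (ρ : Matrix (Fin d) (Fin d) ℂ) :
    Matrix (Fin d) (Fin d) ℂ :=
  (U : Matrix (Fin d) (Fin d) ℂ) * ρ * star (U : Matrix (Fin d) (Fin d) ℂ)

/-- Partial trace over the first tensor factor. -/
def traceFirst {d : ℕ} {n : Type} (M : Matrix (Fin d × n) (Fin d × n) ℂ) : Matrix n n ℂ :=
  Matrix.of fun i j => ∑ k : Fin d, M (k, i) (k, j)

/-- Deterministic combs with two teeth `0 → 1` and `2 → 3`:
`R ≥ 0`, `Tr₃ R = I₂ ⊗ R⁽¹⁾` and `Tr₁ R⁽¹⁾ = I₀`. -/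
def IsDetComb {d : ℕ} (R : Matrix (Wires d) (Wires d) ℂ) : Prop :=
  R.PosSemidef ∧ ∃ R₁ : Matrix (Fin d × Fin d) (Fin d × Fin d) ℂ, R₁.PosSemidef ∧
    traceFirst R = (1 : Matrix (Fin d) (Fin d) ℂ) ⊗ₖ R₁ ∧ traceFirst R₁ = 1

/-- Entrywise integral `∫ dÛ R_Û` of an operator-valued function on `SU(d)`. -/
def integralSU {d : ℕ} (R : SU d → Matrix (Wires d) (Wires d) ℂ) :
    Matrix (Wires d) (Wires d) ℂ :=
  Matrix.of fun a b => ∫ V, R V a b ∂(haarSU d)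

/-- A generalized 2-instrument with outcomes in `SU(d)`, given by its density with respect to the
Haar measure: each `R_Û` is a positive operator and `∫ dÛ R_Û` is a deterministic comb. -/
structure IsInstrument {d : ℕ} (R : SU d → Matrix (Wires d) (Wires d) ℂ) : Prop where
  posSemidef : ∀ V, (R V).PosSemidef
  integrable : ∀ a b, Integrable (fun V => R V a b) (haarSU d)
  isDetComb : IsDetComb (integralSU R)

/-- Link product `R * E = Tr₂₁[R (I₃ ⊗ Eᵀ ⊗ I₀)]` of a comb `R` on the wires `3,2,1,0` with the
Choi operator `E` of a box from wire `1` to wire `2`; the result is the Choi operator, on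
`H₃ ⊗ H₀`, of the resulting operation from wire `0` to wire `3`. -/
def link {d : ℕ} (R : Matrix (Wires d) (Wires d) ℂ)
    (E : Matrix (Fin d × Fin d) (Fin d × Fin d) ℂ) :
    Matrix (Fin d × Fin d) (Fin d × Fin d) ℂ :=
  Matrix.of fun a b => ∑ s : Fin d × Fin d, ∑ t : Fin d × Fin d,
    R (a.1, s.1, s.2, a.2) (b.1, t.1, t.2, b.2) * E.transpose t s

/-- The action `ρ ↦ Tr₀[C (I ⊗ ρᵀ)]` of the operation with Choi operator `C`. -/
def applyChoi {d : ℕ} (C : Matrix (Fin d × Fin d) (Fin d × Fin d) ℂ)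
    (ρ : Matrix (Fin d) (Fin d) ℂ) : Matrix (Fin d) (Fin d) ℂ :=
  Matrix.of fun i j => ∑ m : Fin d, ∑ n : Fin d, C (i, m) (j, n) * ρ.transpose n m

/-! ### Information gain, fidelity and the trade-off -/

/-- Probability (density) of the outcome with operator `S = R_Û`, when the black box performs
`U` and the input state is `ρ`: the trace of the output state. -/
def outcomeProb {d : ℕ} (S : Matrix (Wires d) (Wires d) ℂ) (U : SU d)
    (ρ : Matrix (Fin d) (Fin d) ℂ) : ℝ :=
  (applyChoi (link S (choi (unitaryChannel U))) ρ).trace.re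

/-- `g(Û, U) = |Tr[Û U†]|² / d²`. -/
def guessFidelity {d : ℕ} (V U : SU d) : ℝ :=
  ‖((V : Matrix (Fin d) (Fin d) ℂ) * star (U : Matrix (Fin d) (Fin d) ℂ)).trace‖ ^ 2 / (d : ℝ) ^ 2

/-- Average information gain for the input state `ρ`. -/
def gainOf {d : ℕ} (ρ : Matrix (Fin d) (Fin d) ℂ)
    (R : SU d → Matrix (Wires d) (Wires d) ℂ) : ℝ :=
  ∫ U, ∫ V, outcomeProb (R V) U ρ * guessFidelity V U ∂(haarSU d) ∂(haarSU d)

/-- Average information gain `G` for the input state `I/d`. -/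
def gain {d : ℕ} (R : SU d → Matrix (Wires d) (Wires d) ℂ) : ℝ :=
  gainOf ((d : ℂ)⁻¹ • 1) R

/-- Channel fidelity `⟨⟨U|C|U⟩⟩ / d²` between the operation with Choi operator `C` and the
unitary channel of `U`. -/
def channelFidelity {d : ℕ} (C : Matrix (Fin d × Fin d) (Fin d × Fin d) ℂ) (U : SU d) : ℝ :=
  (star (dket (U : Matrix (Fin d) (Fin d) ℂ)) ⬝ᵥ
    C.mulVec (dket (U : Matrix (Fin d) (Fin d) ℂ))).re / (d : ℝ) ^ 2

/-- Average fidelity `F`. -/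
def fidelity {d : ℕ} (R : SU d → Matrix (Wires d) (Wires d) ℂ) : ℝ :=
  ∫ U, ∫ V, channelFidelity (link (R V) (choi (unitaryChannel U))) U ∂(haarSU d) ∂(haarSU d)

/-- The figure of merit `p G + (1 - p) F`. -/
def merit {d : ℕ} (p : ℝ) (R : SU d → Matrix (Wires d) (Wires d) ℂ) : ℝ :=
  p * gain R + (1 - p) * fidelity R

/-- `R` is a generalized 2-instrument that maximizes `p G + (1 - p) F` among all of them. -/
def IsOptimal {d : ℕ} (p : ℝ) (R : SU d → Matrix (Wires d) (Wires d) ℂ) : Prop :=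
  IsInstrument R ∧ ∀ S : SU d → Matrix (Wires d) (Wires d) ℂ, IsInstrument S → merit p S ≤ merit p R

/-- `|χ_Û⟩ = x |Û⟩⟩₃₀ |Û*⟩⟩₂₁ + y |I⟩⟩₃₂ |I⟩⟩₁₀`. -/
def chi {d : ℕ} (x y : ℝ) (V : SU d) : Wires d → ℂ := fun a =>
  (x : ℂ) * (dket (V : Matrix (Fin d) (Fin d) ℂ) (a.1, a.2.2.2) *
      dket ((V : Matrix (Fin d) (Fin d) ℂ).map star) (a.2.1, a.2.2.1)) +
    (y : ℂ) * (dket 1 (a.1, a.2.1) * dket 1 (a.2.2.1, a.2.2.2))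

/-- `R_Û = |χ_Û⟩⟨χ_Û|`. -/
def chiInstrument (d : ℕ) (x y : ℝ) : SU d → Matrix (Wires d) (Wires d) ℂ := fun V =>
  Matrix.vecMulVec (chi x y V) (star (chi x y V))

/-- The admissible parameters: `x, y ≥ 0` and `x² + y² + 2xy/d = 1`. -/
def Admissible (d : ℕ) (x y : ℝ) : Prop :=
  0 ≤ x ∧ 0 ≤ y ∧ x ^ 2 + y ^ 2 + 2 * x * y / d = 1

/-- Information `I = (G - Gmin) / (Gmax - Gmin)` with `Gmin = 1/d²`, `Gmax = 2/d²`. -/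
def information {d : ℕ} (R : SU d → Matrix (Wires d) (Wires d) ℂ) : ℝ :=
  (gain R - 1 / (d : ℝ) ^ 2) / (2 / (d : ℝ) ^ 2 - 1 / (d : ℝ) ^ 2)

/-- Disturbance `D = (Fmax - F) / (Fmax - Fmin)` with `Fmin = 2/d²`, `Fmax = 1`. -/
def disturbance {d : ℕ} (R : SU d → Matrix (Wires d) (Wires d) ℂ) : ℝ :=
  (1 - fidelity R) / (1 - 2 / (d : ℝ) ^ 2)

end QTradeoff

end

/-!
An instrument enters the figures of merit only through traces.  Integrating over the black box `U`,
the second moment of the Haar measure of `SU(d)` turns the average fidelity into a trace of the comb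
`∫ dÛ R_Û` against a combination of `1`, `P = |I⟩⟩⟨⟨I|₃₂`, `P' = |I⟩⟩⟨⟨I|₁₀` and `P P'`
(`fidelity_eq`), and the average gain into the trace of the comb and the mean of
`Tr[R_Û Q_Û]` with `Q_Û = |Û*⟩⟩⟨⟨Û*|₂₁` (`gain_eq`).  The second moment itself (`integral_four`)
follows from Schur's lemma for the conjugation action of `SU(d)` on matrices (`covariant_map_eq`).

Since `P P' ≤ d P` and `P P' ≤ d P'`, the disturbance is at least the normalized weight of the comb
outside `P` (`le_disturbance`), whereas `1 - I` is the normalized mean weight of `R_Û` outside `Q_Û`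
(`information_eq`).  The two projections `P / d` and `Q_Û / d` satisfy `P Q_Û P = P`: their ranges are
at the constant angle with cosine `1 / d`, so that no vector is close to both.  Quantitatively
(`re_trace_two_projections_le`, a sum-of-squares identity), for all `x, y ≥ 0`,
`d x y ≤ y (d x + y) D + x (d y + x) (1 - I)` for every generalized 2-instrument (`tradeoff_le`).

For admissible `x, y` the instrument `R^{x,y}` has `D = x²` and `1 - I = y²`, which is equality in
this bound.  So the bounds are the tangent lines of the curve `D = x²`, `1 - I = y²`, and each point
of the curve is optimal for the weight `p` whose level lines have the slope of the tangent.  At the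
two endpoints, where the tangent is vertical or horizontal, extremality follows from the neighbouring
tangents (`sq_le_disturbance`, `information_le`).
-/

noncomputable section

namespace QTradeoff

/-! ### Linear maps on matrices that commute with conjugation by `SU(d)` -/

/-- A linear map commuting with conjugation by special unitaries commutes with conjugation by all
unitaries, because a unitary becomes special after multiplication by a phase. -/
theorem map_conj_of_unitary {d : ℕ} (hd : d ≠ 0)
    (Ψ : Matrix (Fin d) (Fin d) ℂ →ₗ[ℂ] Matrix (Fin d) (Fin d) ℂ)
    (h : ∀ (W : SU d) X, Ψ ((W : Matrix (Fin d) (Fin d) ℂ) * X * star (W : Matrix _ _ ℂ)) =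
      (W : Matrix (Fin d) (Fin d) ℂ) * Ψ X * star (W : Matrix (Fin d) (Fin d) ℂ))
    {W : Matrix (Fin d) (Fin d) ℂ} (hW : star W * W = 1) (X : Matrix (Fin d) (Fin d) ℂ) :
    Ψ (W * X * star W) = W * Ψ X * star W := by
  have hdet : star W.det * W.det = 1 := by
    have := congrArg Matrix.det hW
    rwa [Matrix.det_mul, Matrix.star_eq_conjTranspose, Matrix.det_conjTranspose,
      Matrix.det_one] at this
  obtain ⟨ζ, hζ⟩ := IsAlgClosed.exists_pow_nat_eq (star W.det) (Nat.pos_of_ne_zero hd)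
  have hn : ‖W.det‖ = 1 := by
    have h1 := congrArg norm hdet
    rw [norm_mul, norm_star, norm_one] at h1
    nlinarith [norm_nonneg W.det]
  have hζn : ‖ζ‖ = 1 := by
    have h1 := congrArg norm hζ
    rw [norm_pow, norm_star, hn] at h1
    exact (pow_eq_one_iff_of_nonneg (norm_nonneg ζ) hd).1 h1
  have hζ1 : star ζ * ζ = 1 := by
    have := Complex.conj_mul' ζ
    rw [hζn] at this
    simpa using this
  have hζ2 : ζ * star ζ = 1 := by rw [mul_comm]; exact hζ1
  have hmem : ζ • W ∈ Matrix.specialUnitaryGroup (Fin d) ℂ := by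
    rw [Matrix.mem_specialUnitaryGroup_iff]
    refine ⟨Matrix.mem_unitaryGroup_iff'.2 ?_, ?_⟩
    · rw [star_smul, smul_mul_smul_comm, hζ1, hW, one_smul]
    · rw [Matrix.det_smul, Fintype.card_fin, hζ, hdet]
  have key := h ⟨ζ • W, hmem⟩ X
  simp only [star_smul, smul_mul_assoc, mul_smul_comm, smul_smul, hζ1, one_smul] at key
  exact key

/-- Conjugating by `1 + (z - 1) N` with `z = ± i` shows that a covariant map commutes with the
commutator with a projection. -/
theorem map_commutator_of_proj {d : ℕ} (hd : d ≠ 0)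
    (Ψ : Matrix (Fin d) (Fin d) ℂ →ₗ[ℂ] Matrix (Fin d) (Fin d) ℂ)
    (h : ∀ (W : SU d) X, Ψ ((W : Matrix (Fin d) (Fin d) ℂ) * X * star (W : Matrix _ _ ℂ)) =
      (W : Matrix (Fin d) (Fin d) ℂ) * Ψ X * star (W : Matrix (Fin d) (Fin d) ℂ))
    {N : Matrix (Fin d) (Fin d) ℂ} (hN : star N = N) (hN2 : N * N = N)
    (X : Matrix (Fin d) (Fin d) ℂ) :
    Ψ (N * X - X * N) = N * Ψ X - Ψ X * N := by
  have hs : ∀ z : ℂ, star (1 + (z - 1) • N) = 1 + (star z - 1) • N := by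
    intro z
    rw [star_add, star_smul, star_one, hN, star_sub, star_one]
  have hW : ∀ z : ℂ, star z * z = 1 → star (1 + (z - 1) • N) * (1 + (z - 1) • N) = 1 := by
    intro z hz
    rw [hs]
    simp only [mul_add, add_mul, one_mul, mul_one, smul_mul_smul_comm, hN2]
    rw [add_assoc, ← add_smul, ← add_smul]
    have : star z - 1 + (z - 1 + (star z - 1) * (z - 1)) = 0 := by
      linear_combination hz
    rw [this]; simp
  have hexp : ∀ (z : ℂ) (Y : Matrix (Fin d) (Fin d) ℂ),
      (1 + (z - 1) • N) * Y * (1 + (star z - 1) • N) =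
        Y + (z - 1) • (N * Y) + (star z - 1) • (Y * N) +
          ((z - 1) * (star z - 1)) • (N * Y * N) := by
    intro z Y
    simp only [mul_add, add_mul, one_mul, mul_one, smul_mul_assoc, mul_smul_comm]
    module
  have e1 := map_conj_of_unitary hd Ψ h (hW Complex.I (by simp)) X
  have e2 := map_conj_of_unitary hd Ψ h (hW (-Complex.I) (by simp)) X
  rw [hs, hexp, hexp] at e1 e2
  simp only [map_add, map_smul] at e1 e2
  rw [map_sub]
  have e3 : (2 * Complex.I) • (Ψ (N * X) - Ψ (X * N)) =
      (2 * Complex.I) • (N * Ψ X - Ψ X * N) := by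
    ext i j
    have f1 := congrFun (congrFun e1 i) j
    have f2 := congrFun (congrFun e2 i) j
    simp only [Matrix.add_apply, Matrix.smul_apply, Matrix.sub_apply, smul_eq_mul,
      Complex.star_def, Complex.conj_I, map_neg] at f1 f2 ⊢
    linear_combination f1 - f2
  exact smul_right_injective _ (by simp) e3

/-- Projections span all matrices, so a covariant map commutes with every commutator. -/
theorem map_commutator {d : ℕ} (hd : d ≠ 0)
    (Ψ : Matrix (Fin d) (Fin d) ℂ →ₗ[ℂ] Matrix (Fin d) (Fin d) ℂ)
    (h : ∀ (W : SU d) X, Ψ ((W : Matrix (Fin d) (Fin d) ℂ) * X * star (W : Matrix _ _ ℂ)) =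
      (W : Matrix (Fin d) (Fin d) ℂ) * Ψ X * star (W : Matrix (Fin d) (Fin d) ℂ))
    (A X : Matrix (Fin d) (Fin d) ℂ) :
    Ψ (A * X - X * A) = A * Ψ X - Ψ X * A := by
  have hadd : ∀ A B, Ψ (A * X - X * A) = A * Ψ X - Ψ X * A →
      Ψ (B * X - X * B) = B * Ψ X - Ψ X * B →
      Ψ ((A + B) * X - X * (A + B)) = (A + B) * Ψ X - Ψ X * (A + B) := by
    intro A B hA hB
    have : (A + B) * X - X * (A + B) = (A * X - X * A) + (B * X - X * B) := by noncomm_ring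
    rw [this, map_add, hA, hB]; noncomm_ring
  have hsmul : ∀ (z : ℂ) A, Ψ (A * X - X * A) = A * Ψ X - Ψ X * A →
      Ψ ((z • A) * X - X * (z • A)) = (z • A) * Ψ X - Ψ X * (z • A) := by
    intro z A hA
    simp only [smul_mul_assoc, mul_smul_comm, ← smul_sub, map_smul, hA]
  have hdiag : ∀ i : Fin d, Ψ (Matrix.single i i 1 * X - X * Matrix.single i i 1) =
      Matrix.single i i 1 * Ψ X - Ψ X * Matrix.single i i 1 := by
    intro i
    exact map_commutator_of_proj hd Ψ h (by simp [Matrix.star_eq_conjTranspose]) (by simp) X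
  have hsingle : ∀ (i j : Fin d), Ψ (Matrix.single i j 1 * X - X * Matrix.single i j 1) =
      Matrix.single i j 1 * Ψ X - Ψ X * Matrix.single i j 1 := by
    intro i j
    by_cases hij : i = j
    · subst hij; exact hdiag i
    -- the projections onto `(eᵢ + eⱼ)/√2` and `(eᵢ + i eⱼ)/√2`
    have hproj : ∀ z : ℂ, star z * z = 1 →
        Ψ (((1 / 2 : ℂ) • (Matrix.single i i 1 + Matrix.single j j 1 + (star z) • Matrix.single i j 1
          + z • Matrix.single j i 1)) * X - X * ((1 / 2 : ℂ) • (Matrix.single i i 1 +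
          Matrix.single j j 1 + (star z) • Matrix.single i j 1 + z • Matrix.single j i 1))) =
        ((1 / 2 : ℂ) • (Matrix.single i i 1 + Matrix.single j j 1 + (star z) • Matrix.single i j 1
          + z • Matrix.single j i 1)) * Ψ X - Ψ X * ((1 / 2 : ℂ) • (Matrix.single i i 1 +
          Matrix.single j j 1 + (star z) • Matrix.single i j 1 + z • Matrix.single j i 1)) := by
      intro z hz
      have hz' : z * star z = 1 := by rw [mul_comm]; exact hz
      refine map_commutator_of_proj hd Ψ h ?_ ?_ X
      · simp only [Matrix.star_eq_conjTranspose, Matrix.conjTranspose_smul,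
          Matrix.conjTranspose_add, Matrix.conjTranspose_single, star_star, star_one]
        congr 1
        · simp
        · abel
      · simp only [smul_mul_smul_comm, mul_add, add_mul]
        simp only [smul_mul_assoc, mul_smul_comm, Matrix.single_mul_single_same,
          Matrix.single_mul_single_of_ne _ _ _ _ hij,
          Matrix.single_mul_single_of_ne _ _ _ _ (Ne.symm hij),
          mul_one, smul_zero, add_zero, zero_add, hz, hz', one_smul]
        module
    have h1 := hproj 1 (by simp)
    have h2 := hproj Complex.I (by simp)
    -- `E_ij` is a combination of these two projections and of `E_ii + E_jj`
    have hE : (Matrix.single i j 1 : Matrix (Fin d) (Fin d) ℂ) =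
        ((1 / 2 : ℂ) • (Matrix.single i i 1 + Matrix.single j j 1 +
          (star (1 : ℂ)) • Matrix.single i j 1 + (1 : ℂ) • Matrix.single j i 1)) +
        Complex.I • ((1 / 2 : ℂ) • (Matrix.single i i 1 + Matrix.single j j 1 +
          (star Complex.I) • Matrix.single i j 1 + Complex.I • Matrix.single j i 1)) +
        (-(1 + Complex.I) / 2) • (Matrix.single i i 1 + Matrix.single j j 1) := by
      ext a b
      simp only [Matrix.add_apply, Matrix.smul_apply, smul_eq_mul, Complex.star_def,
        Complex.conj_I, map_one]
      linear_combination (1 / 2 * Matrix.single i j (1 : ℂ) a b -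
        1 / 2 * Matrix.single j i (1 : ℂ) a b) * Complex.I_mul_I
    rw [hE]
    exact hadd _ _ (hadd _ _ h1 (hsmul _ _ h2)) (hsmul _ _ (hadd _ _ (hdiag i) (hdiag j)))
  induction A using Matrix.induction_on' with
  | h_zero => simp
  | h_add A B hA hB => exact hadd _ _ hA hB
  | h_std_basis i j z =>
    have := hsmul z _ (hsingle i j)
    simpa using this

theorem commutator_single_apply {d : ℕ} (k : Fin d) (Y : Matrix (Fin d) (Fin d) ℂ)
    (a b : Fin d) : (Matrix.single k k (1 : ℂ) * Y - Y * Matrix.single k k (1 : ℂ)) a b =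
      ((if a = k then 1 else 0) - (if b = k then 1 else 0)) * Y a b := by
  rw [Matrix.sub_apply, sub_mul]
  congr 1
  · by_cases h : a = k
    · subst h; simp
    · simp [h]
  · by_cases h : b = k
    · subst h; simp
    · simp [h]

theorem eq_smul_one_of_commute {d : ℕ} (i₀ : Fin d) {B : Matrix (Fin d) (Fin d) ℂ}
    (h : ∀ A, A * B - B * A = 0) : B = B i₀ i₀ • 1 := by
  ext i j
  have h1 := congrFun (congrFun (h (Matrix.single i₀ i 1)) i₀) j
  simp only [Matrix.sub_apply, Matrix.single_mul_apply_same, one_mul, Matrix.zero_apply] at h1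
  by_cases hij : i = j
  · subst hij
    simp at h1
    simp
    linear_combination h1
  · simp [Matrix.mul_apply, hij] at h1
    simp [hij, h1]

/-- Schur's lemma for the conjugation action: the only covariant linear maps are combinations of
the identity and of `X ↦ (tr X) 1`.  The kernel of `Ψ - α` is closed under commutators, so it
contains all traceless matrices as soon as it contains one off-diagonal matrix unit. -/
theorem covariant_map_eq {d : ℕ} (hd : 2 ≤ d)
    (Ψ : Matrix (Fin d) (Fin d) ℂ →ₗ[ℂ] Matrix (Fin d) (Fin d) ℂ)
    (h : ∀ (W : SU d) X, Ψ ((W : Matrix (Fin d) (Fin d) ℂ) * X * star (W : Matrix _ _ ℂ)) =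
      (W : Matrix (Fin d) (Fin d) ℂ) * Ψ X * star (W : Matrix (Fin d) (Fin d) ℂ)) :
    ∃ α β : ℂ, ∀ X, Ψ X = α • X + (β * X.trace) • 1 := by
  have hc := map_commutator (by omega) Ψ h
  let p : Fin d := ⟨0, by omega⟩
  let q : Fin d := ⟨1, by omega⟩
  have hpq : p ≠ q := by simp [p, q]
  -- commutators with `E_pp` and `E_qq` single out the weight space spanned by `E_pq`
  obtain ⟨α, hα⟩ : ∃ α : ℂ, Ψ (Matrix.single p q 1) = α • Matrix.single p q 1 := by
    refine ⟨Ψ (Matrix.single p q 1) p q, ?_⟩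
    have h1 := hc (Matrix.single p p 1) (Matrix.single p q 1)
    have h2 := hc (Matrix.single q q 1) (Matrix.single p q 1)
    simp only [Matrix.single_mul_single_same, mul_one, zero_sub, sub_zero, map_neg,
      Matrix.single_mul_single_of_ne _ _ _ _ hpq.symm] at h1 h2
    ext a b
    have f1 := congrFun (congrFun h1 a) b
    have f2 := congrFun (congrFun h2 a) b
    rw [commutator_single_apply] at f1 f2
    rw [Matrix.neg_apply] at f2
    rw [Matrix.smul_apply, Matrix.single_apply]
    by_cases ha : a = p
    · subst ha
      by_cases hb : b = q
      · subst hb; simp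
      · rw [if_neg hpq, if_neg hb] at f2
        rw [if_neg (fun hh => hb hh.2.symm)]
        simpa using f2
    · rw [if_neg (fun hh => ha hh.1.symm)]
      rw [if_neg ha] at f1
      split_ifs at f1 with hb
      · simp only [smul_zero]; linear_combination (1 / 2 : ℂ) * f1
      · simpa using f1
  let Θ : Matrix (Fin d) (Fin d) ℂ →ₗ[ℂ] Matrix (Fin d) (Fin d) ℂ := Ψ - α • LinearMap.id
  have hΘ : ∀ A X, Θ (A * X - X * A) = A * Θ X - Θ X * A := by
    intro A X
    simp only [Θ, LinearMap.sub_apply, LinearMap.smul_apply, LinearMap.id_apply, hc]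
    simp only [mul_sub, sub_mul, smul_sub, mul_smul_comm, smul_mul_assoc]
    abel
  have hker : ∀ A X, Θ X = 0 → Θ (A * X - X * A) = 0 := by
    intro A X hX; rw [hΘ, hX]; simp
  have hrow : ∀ i j k : Fin d, k ≠ j → Θ (Matrix.single i j 1) = 0 →
      Θ (Matrix.single k j 1) = 0 := by
    intro i j k hkj hX
    have := hker (Matrix.single k i 1) _ hX
    simpa [Matrix.single_mul_single_of_ne _ _ _ _ hkj.symm] using this
  have hcol : ∀ i j k : Fin d, i ≠ k → Θ (Matrix.single i j 1) = 0 →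
      Θ (Matrix.single i k 1) = 0 := by
    intro i j k hik hX
    have := hker (Matrix.single j k 1) _ hX
    simpa [Matrix.single_mul_single_of_ne _ _ _ _ hik.symm] using this
  have hdif : ∀ i j : Fin d, Θ (Matrix.single i j 1) = 0 →
      Θ (Matrix.single j j 1 - Matrix.single i i 1) = 0 := by
    intro i j hX
    have := hker (Matrix.single j i 1) _ hX
    simpa only [Matrix.single_mul_single_same, mul_one] using this
  have hswap : ∀ i j : Fin d, i ≠ j → Θ (Matrix.single i j 1) = 0 →
      Θ (Matrix.single j i 1) = 0 := by
    intro i j hij hX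
    have := hker (Matrix.single j i 1) _ (hdif i j hX)
    simp only [mul_sub, sub_mul, Matrix.single_mul_single_same, mul_one,
      Matrix.single_mul_single_of_ne _ _ _ _ hij, zero_sub, sub_zero] at this
    rw [← neg_add', map_neg, neg_eq_zero, ← two_smul ℂ, map_smul] at this
    exact (smul_eq_zero.1 this).resolve_left two_ne_zero
  have hpq0 : Θ (Matrix.single p q 1) = 0 := by
    simp [Θ, hα]
  have hoff : ∀ k l : Fin d, k ≠ l → Θ (Matrix.single k l 1) = 0 := by
    intro k l hkl
    by_cases hk : k = q
    · exact hcol k p l hkl (hk ▸ hswap p q hpq hpq0)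
    · exact hcol k q l hkl (hrow p q k hk hpq0)
  have hdg : ∀ k : Fin d, Θ (Matrix.single k k 1) = Θ (Matrix.single p p 1) := by
    intro k
    by_cases hk : k = p
    · rw [hk]
    · exact sub_eq_zero.1 (by rw [← map_sub]; exact hdif p k (hoff p k (Ne.symm hk)))
  have htr : ∀ X, Θ X = X.trace • Θ (Matrix.single p p 1) := by
    intro X
    induction X using Matrix.induction_on' with
    | h_zero => simp
    | h_add A B hA hB => rw [map_add, hA, hB, Matrix.trace_add, add_smul]
    | h_std_basis i j z =>
      have hz : Matrix.single i j z = z • Matrix.single i j (1 : ℂ) := by simp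
      rw [hz, map_smul, Matrix.trace_smul]
      by_cases hij : i = j
      · subst hij; rw [hdg]; simp
      · rw [hoff i j hij]; simp [Matrix.trace_single_eq_of_ne _ _ _ hij]
  have hB : ∀ A, A * Θ (Matrix.single p p 1) - Θ (Matrix.single p p 1) * A = 0 := by
    intro A
    rw [← hΘ, htr, Matrix.trace_sub, Matrix.trace_mul_comm, sub_self, zero_smul]
  refine ⟨α, Θ (Matrix.single p p 1) p p, fun X => ?_⟩
  have h1 : Ψ X = α • X + Θ X := by simp [Θ]
  rw [h1, htr X, eq_smul_one_of_commute p hB, smul_smul]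
  simp [mul_comm]

/-! ### Moments of the Haar measure -/

instance instIsMulLeftInvariantHaarSU (d : ℕ) : (haarSU d).IsMulLeftInvariant := by
  unfold haarSU; infer_instance

instance instSecondCountableTopologySU (d : ℕ) : SecondCountableTopology (SU d) :=
  haveI : SecondCountableTopology (Matrix (Fin d) (Fin d) ℂ) :=
    inferInstanceAs (SecondCountableTopology (Fin d → Fin d → ℂ))
  TopologicalSpace.Subtype.secondCountableTopology _

theorem integrable_of_continuous {d : ℕ} {E : Type*} [NormedAddCommGroup E] {f : SU d → E}
    (hf : Continuous f) : Integrable f (haarSU d) :=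
  hf.integrable_of_hasCompactSupport (HasCompactSupport.of_compactSpace f)

theorem star_mul_self_SU {d : ℕ} (U : SU d) : star U.1 * U.1 = 1 :=
  Matrix.mem_unitaryGroup_iff'.1 (Matrix.mem_specialUnitaryGroup_iff.1 U.2).1

theorem mul_star_self_SU {d : ℕ} (U : SU d) : U.1 * star U.1 = 1 :=
  Matrix.mem_unitaryGroup_iff.1 (Matrix.mem_specialUnitaryGroup_iff.1 U.2).1

theorem sum_star_mul_SU {d : ℕ} (U : SU d) (i j : Fin d) :
    ∑ k, star (U.1 k i) * U.1 k j = if i = j then 1 else 0 := by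
  have := congrFun (congrFun (star_mul_self_SU U) i) j
  rwa [Matrix.mul_apply, Matrix.one_apply] at this

theorem sum_mul_star_SU {d : ℕ} (U : SU d) (i j : Fin d) :
    ∑ k, U.1 i k * star (U.1 j k) = if i = j then 1 else 0 := by
  have := congrFun (congrFun (mul_star_self_SU U) i) j
  rwa [Matrix.mul_apply, Matrix.one_apply] at this

theorem continuous_coe_apply {d : ℕ} (i j : Fin d) : Continuous fun U : SU d => U.1 i j :=
  continuous_subtype_val.matrix_elem i j

/-- Entrywise integral of a matrix-valued function on `SU(d)`. -/
def haarMat {d : ℕ} (f : SU d → Matrix (Fin d) (Fin d) ℂ) : Matrix (Fin d) (Fin d) ℂ :=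
  Matrix.of fun a b => ∫ U, f U a b ∂(haarSU d)

theorem haarMat_mul_mul {d : ℕ} {f : SU d → Matrix (Fin d) (Fin d) ℂ} (hf : Continuous f)
    (A B : Matrix (Fin d) (Fin d) ℂ) :
    haarMat (fun U => A * f U * B) = A * haarMat f * B := by
  ext a b
  have hi : ∀ i j, Integrable (fun U => f U i j) (haarSU d) := fun i j =>
    integrable_of_continuous (hf.matrix_elem i j)
  simp only [haarMat, Matrix.mul_apply, Matrix.of_apply]
  rw [integral_finsetSum _ fun j _ =>
    (integrable_finsetSum _ fun i _ => (hi i j).const_mul _).mul_const _]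
  refine Finset.sum_congr rfl fun j _ => ?_
  rw [integral_mul_const, integral_finsetSum _ fun i _ => (hi i j).const_mul _]
  simp only [integral_const_mul]

theorem haarMat_mul_left {d : ℕ} (f : SU d → Matrix (Fin d) (Fin d) ℂ) (W : SU d) :
    haarMat (fun U => f (W * U)) = haarMat f := by
  ext a b
  exact integral_mul_left_eq_self (fun U => f U a b) W

/-- The covariant map `X ↦ ∫ dU (U B U†) X (U C U†)`. -/
def twirl {d : ℕ} (B C : Matrix (Fin d) (Fin d) ℂ) :
    Matrix (Fin d) (Fin d) ℂ →ₗ[ℂ] Matrix (Fin d) (Fin d) ℂ where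
  toFun X := haarMat fun U => U.1 * B * star U.1 * X * (U.1 * C * star U.1)
  map_add' X Y := by
    ext a b
    simp only [haarMat, Matrix.add_apply, Matrix.of_apply]
    rw [← integral_add]
    · simp only [mul_add, add_mul, Matrix.add_apply]
    · exact integrable_of_continuous (Continuous.matrix_elem (by fun_prop) a b)
    · exact integrable_of_continuous (Continuous.matrix_elem (by fun_prop) a b)
  map_smul' z X := by
    ext a b
    simp only [haarMat, Matrix.smul_apply, Matrix.of_apply, mul_smul_comm, smul_mul_assoc,
      RingHom.id_apply]
    exact integral_smul z _

theorem twirl_conj {d : ℕ} (B C : Matrix (Fin d) (Fin d) ℂ) (W : SU d)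
    (X : Matrix (Fin d) (Fin d) ℂ) :
    twirl B C (W.1 * X * star W.1) = W.1 * twirl B C X * star W.1 := by
  change haarMat _ = W.1 * haarMat _ * star W.1
  rw [← haarMat_mul_mul (by fun_prop), ← haarMat_mul_left _ W]
  congr 1
  funext U
  have hW := star_mul_self_SU W
  have e : (W * U).1 = W.1 * U.1 := rfl
  rw [e, star_mul]
  calc _ = W.1 * U.1 * B * star U.1 * (star W.1 * W.1) * X * (star W.1 * W.1) * U.1 * C *
        star U.1 * star W.1 := by noncomm_ring
    _ = _ := by rw [hW]; noncomm_ring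

/-- First moment: `∫ dU U C U† = (tr C / d) 1`. -/
theorem haarMat_conj {d : ℕ} (hd : 2 ≤ d) (C : Matrix (Fin d) (Fin d) ℂ) :
    haarMat (fun U => U.1 * C * star U.1) = (C.trace / d) • 1 := by
  set Y := haarMat (fun U => U.1 * C * star U.1) with hY
  have hYW : ∀ W : SU d, W.1 * Y * star W.1 = Y := by
    intro W
    rw [hY, ← haarMat_mul_mul (by fun_prop), ← haarMat_mul_left (fun U => U.1 * C * star U.1) W]
    congr 1
    funext U
    have e : (W * U).1 = W.1 * U.1 := rfl
    rw [e, star_mul]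
    noncomm_ring
  let p : Fin d := ⟨0, by omega⟩
  -- covariance of `X ↦ (tr X) Y` means that `Y` commutes with everything
  have hcomm := map_commutator (by omega) ((Matrix.traceLinearMap (Fin d) ℂ ℂ).smulRight Y) (by
    intro W X
    simp only [LinearMap.smulRight_apply, Matrix.traceLinearMap_apply, mul_smul_comm,
      smul_mul_assoc, hYW]
    rw [Matrix.trace_mul_comm, ← mul_assoc, star_mul_self_SU, one_mul])
  have h1 : Y = Y p p • 1 := by
    refine eq_smul_one_of_commute p fun A => ?_
    have := hcomm A (Matrix.single p p 1)
    simpa [Matrix.trace_sub, Matrix.trace_mul_comm A] using this.symm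
  have htr : Y.trace = C.trace := by
    have : ∀ U : SU d, (U.1 * C * star U.1).trace = C.trace := by
      intro U
      rw [Matrix.trace_mul_comm, ← mul_assoc, star_mul_self_SU, one_mul]
    simp only [hY, haarMat, Matrix.trace, Matrix.diag, Matrix.of_apply]
    rw [← integral_finsetSum _ fun i _ =>
      integrable_of_continuous (Continuous.matrix_elem (by fun_prop) i i)]
    simp only [Matrix.trace, Matrix.diag] at this
    simp [this]
  rw [h1] at htr ⊢
  have hd0 : (d : ℂ) ≠ 0 := by exact_mod_cast (by omega : d ≠ 0)
  rw [Matrix.trace_smul, Matrix.trace_one, Fintype.card_fin, smul_eq_mul] at htr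
  rw [← htr, mul_div_cancel_right₀ _ hd0]

theorem integral_two {d : ℕ} (hd : 2 ≤ d) (a b c e : Fin d) :
    ∫ U, U.1 a b * star (U.1 c e) ∂(haarSU d) =
      if a = c ∧ b = e then (d : ℂ)⁻¹ else 0 := by
  have h := congrFun (congrFun (haarMat_conj hd (Matrix.single b e 1)) a) c
  have h1 : ∀ U : SU d, (U.1 * Matrix.single b e (1 : ℂ) * star U.1) a c = U.1 a b * star (U.1 c e) := by
    intro U
    simp [Matrix.mul_apply, Matrix.single_apply, Matrix.star_apply, ite_and]
  simp only [haarMat, Matrix.of_apply, h1] at h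
  rw [h]
  by_cases hac : a = c
  · by_cases hbe : b = e
    · subst hac hbe; simp
    · simp [hac, hbe, Matrix.trace_single_eq_of_ne _ _ _ hbe]
  · simp [hac]

/-- Second moment: Schur's lemma leaves two unknown coefficients, which the two contractions to a
first moment determine. -/
theorem integral_conj_mul_conj {d : ℕ} (hd : 2 ≤ d) (B C : Matrix (Fin d) (Fin d) ℂ)
    (a c g e : Fin d) :
    ∫ U, (U.1 * B * star U.1) a c * (U.1 * C * star U.1) g e ∂(haarSU d) =
      ((d : ℂ) ^ 2 - 1)⁻¹ *
        ((B.trace * C.trace - (B * C).trace / d) * ((1 : Matrix (Fin d) (Fin d) ℂ) a c *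
          (1 : Matrix (Fin d) (Fin d) ℂ) g e) +
        ((B * C).trace - B.trace * C.trace / d) * ((1 : Matrix (Fin d) (Fin d) ℂ) a e *
          (1 : Matrix (Fin d) (Fin d) ℂ) c g)) := by
  have hd0 : (d : ℂ) ≠ 0 := by exact_mod_cast (by omega : d ≠ 0)
  have hd1 : (d : ℂ) ^ 2 - 1 ≠ 0 := by
    have : (1 : ℕ) < d ^ 2 := Nat.one_lt_pow (by norm_num) (by omega)
    rw [sub_ne_zero]
    exact_mod_cast this.ne'
  obtain ⟨α, β, h⟩ := covariant_map_eq hd (twirl B C) (twirl_conj B C)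
  have hentry : ∀ a c g e : Fin d,
      ∫ U, (U.1 * B * star U.1) a c * (U.1 * C * star U.1) g e ∂(haarSU d) =
      α * ((1 : Matrix (Fin d) (Fin d) ℂ) a c * (1 : Matrix (Fin d) (Fin d) ℂ) g e) +
        β * ((1 : Matrix (Fin d) (Fin d) ℂ) a e * (1 : Matrix (Fin d) (Fin d) ℂ) c g) := by
    intro a c g e
    have h1 := congrFun (congrFun (h (Matrix.single c g 1)) a) e
    have h2 : ∀ M N : Matrix (Fin d) (Fin d) ℂ,
        (M * Matrix.single c g (1 : ℂ) * N) a e = M a c * N g e := by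
      intro M N
      simp [Matrix.mul_apply, Matrix.single_apply, ite_and]
    have h3 : twirl B C (Matrix.single c g 1) a e =
        ∫ U, (U.1 * B * star U.1 * Matrix.single c g (1 : ℂ) * (U.1 * C * star U.1)) a e
          ∂(haarSU d) := rfl
    simp only [h3, h2] at h1
    rw [h1]
    simp only [Matrix.add_apply, Matrix.smul_apply, smul_eq_mul]
    congr 1
    · simp only [Matrix.single_apply, Matrix.one_apply, eq_comm (a := c)]
      split_ifs <;> simp_all
    · by_cases hcg : c = g
      · subst hcg; simp
      · simp [Matrix.trace_single_eq_of_ne _ _ _ hcg, hcg]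
  have hcont : ∀ (B : Matrix (Fin d) (Fin d) ℂ) i j,
      Continuous fun U : SU d => (U.1 * B * star U.1) i j := fun B i j =>
    Continuous.matrix_elem (by fun_prop) i j
  have hint : ∀ a c g e, Integrable
      (fun U : SU d => (U.1 * B * star U.1) a c * (U.1 * C * star U.1) g e) (haarSU d) :=
    fun a c g e => integrable_of_continuous ((hcont B a c).mul (hcont C g e))
  let p : Fin d := ⟨0, by omega⟩
  have hfirst : ∀ (D : Matrix (Fin d) (Fin d) ℂ),
      ∫ U, (U.1 * D * star U.1) p p ∂(haarSU d) = D.trace / d := by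
    intro D
    have := congrFun (congrFun (haarMat_conj hd D) p) p
    simpa [haarMat] using this
  -- contracting the inner indices
  have e1 : α + β * d = (B * C).trace / d := by
    have hs : ∑ c, ∫ U, (U.1 * B * star U.1) p c * (U.1 * C * star U.1) c p ∂(haarSU d) =
        (B * C).trace / d := by
      rw [← integral_finsetSum _ fun c _ => hint p c c p, ← hfirst]
      congr 1
      funext U
      rw [← Matrix.mul_apply]
      have : U.1 * B * star U.1 * (U.1 * C * star U.1) = U.1 * (B * C) * star U.1 := by
        calc _ = U.1 * B * (star U.1 * U.1) * C * star U.1 := by noncomm_ring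
          _ = _ := by rw [star_mul_self_SU, mul_one, mul_assoc U.1 B C]
      rw [this]
    rw [← hs]
    simp only [hentry, Finset.sum_add_distrib, ← Finset.mul_sum, Matrix.one_apply]
    simp
  -- contracting the first pair of indices
  have e2 : α * d + β = B.trace * C.trace / d := by
    have hs : ∑ a, ∫ U, (U.1 * B * star U.1) a a * (U.1 * C * star U.1) p p ∂(haarSU d) =
        B.trace * C.trace / d := by
      rw [← integral_finsetSum _ fun a _ => hint a a p p, mul_div_assoc, ← hfirst,
        ← integral_const_mul]
      congr 1
      funext U
      rw [← Finset.sum_mul]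
      congr 1
      have : (U.1 * B * star U.1).trace = B.trace := by
        rw [Matrix.trace_mul_comm, ← mul_assoc, star_mul_self_SU, one_mul]
      exact this
    rw [← hs]
    simp only [hentry, Finset.sum_add_distrib, ← Finset.mul_sum, Matrix.one_apply]
    simp
  rw [hentry]
  have hα : α = ((d : ℂ) ^ 2 - 1)⁻¹ * (B.trace * C.trace - (B * C).trace / d) := by
    rw [← e1]
    field_simp at e2 ⊢
    linear_combination e2
  have hβ : β = ((d : ℂ) ^ 2 - 1)⁻¹ * ((B * C).trace - B.trace * C.trace / d) := by
    rw [← e2]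
    field_simp at e1 ⊢
    linear_combination e1
  rw [hα, hβ]
  ring

theorem integral_four {d : ℕ} (hd : 2 ≤ d) (a b c e g h k l : Fin d) :
    ∫ U, U.1 a b * star (U.1 c e) * (U.1 g h * star (U.1 k l)) ∂(haarSU d) =
      ((d : ℂ) ^ 2 - 1)⁻¹ *
        (((1 : Matrix (Fin d) (Fin d) ℂ) b e * (1 : Matrix (Fin d) (Fin d) ℂ) h l -
          (1 : Matrix (Fin d) (Fin d) ℂ) h e * (1 : Matrix (Fin d) (Fin d) ℂ) b l / d) *
          ((1 : Matrix (Fin d) (Fin d) ℂ) a c * (1 : Matrix (Fin d) (Fin d) ℂ) g k) +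
        ((1 : Matrix (Fin d) (Fin d) ℂ) h e * (1 : Matrix (Fin d) (Fin d) ℂ) b l -
          (1 : Matrix (Fin d) (Fin d) ℂ) b e * (1 : Matrix (Fin d) (Fin d) ℂ) h l / d) *
          ((1 : Matrix (Fin d) (Fin d) ℂ) a k * (1 : Matrix (Fin d) (Fin d) ℂ) c g)) := by
  have h1 : ∀ (U : SU d) (a b c e : Fin d),
      (U.1 * Matrix.single b e (1 : ℂ) * star U.1) a c = U.1 a b * star (U.1 c e) := by
    intro U a b c e
    simp [Matrix.mul_apply, Matrix.single_apply, Matrix.star_apply, ite_and]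
  have h2 : ∀ b e : Fin d, (Matrix.single b e (1 : ℂ)).trace =
      (1 : Matrix (Fin d) (Fin d) ℂ) b e := by
    intro b e
    by_cases hbe : b = e
    · subst hbe; simp
    · simp [Matrix.trace_single_eq_of_ne _ _ _ hbe, hbe]
  have h3 : (Matrix.single b e (1 : ℂ) * Matrix.single h l (1 : ℂ)).trace =
      (1 : Matrix (Fin d) (Fin d) ℂ) h e * (1 : Matrix (Fin d) (Fin d) ℂ) b l := by
    by_cases he : e = h
    · subst he; simp [h2]
    · rw [Matrix.single_mul_single_of_ne _ _ _ _ he]; simp [Ne.symm he]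
  have := integral_conj_mul_conj hd (Matrix.single b e 1) (Matrix.single h l 1) a c g k
  simpa only [h1, h2, h3] using this

/-! ### Two projections at a fixed angle -/

theorem re_trace_mul_conjTranspose_mul_nonneg {n : Type*} [Fintype n]
    {R : Matrix n n ℂ} (hR : R.PosSemidef) (X : Matrix n n ℂ) :
    0 ≤ (R * (X.conjTranspose * X)).trace.re := by
  rw [← mul_assoc, Matrix.trace_mul_comm, ← mul_assoc]
  exact (Complex.nonneg_iff.1 (hR.mul_mul_conjTranspose_same X).trace_nonneg).1

/-- Let `P / δ` and `Q / δ` be projections with `P Q P = P`, so that the cosine of the angle between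
their ranges is `1 / δ`.  With `a = δ x + y` and `b = δ y + x`, the operator `a b - y a P - x b Q`
is nonnegative, because `a b` times it is its square plus a multiple of `Zᴴ Z` for
`Z = a Q P - b Q`. -/
theorem re_trace_two_projections_le {n : Type*} [Fintype n] [DecidableEq n] {P Q R : Matrix n n ℂ}
    {δ : ℝ} (hδ : 0 < δ) (hP : P.conjTranspose = P) (hQ : Q.conjTranspose = Q)
    (hPP : P * P = (δ : ℂ) • P) (hQQ : Q * Q = (δ : ℂ) • Q) (hPQP : P * Q * P = P)
    (hR : R.PosSemidef) {x y : ℝ} (hx : 0 ≤ x) (hy : 0 ≤ y) :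
    y * (δ * x + y) * (R * P).trace.re + x * (δ * y + x) * (R * Q).trace.re ≤
      (δ * x + y) * (δ * y + x) * R.trace.re := by
  set a : ℝ := δ * x + y with ha
  set b : ℝ := δ * y + x with hb
  have ha0 : 0 ≤ a := by positivity
  have hb0 : 0 ≤ b := by positivity
  let X : Matrix n n ℂ := ((a * b : ℝ) : ℂ) • 1 - ((y * a : ℝ) : ℂ) • P - ((x * b : ℝ) : ℂ) • Q
  let Z : Matrix n n ℂ := (a : ℂ) • (Q * P) - (b : ℂ) • Q
  have hX : X.conjTranspose = X := by
    simp only [X, Matrix.conjTranspose_sub, Matrix.conjTranspose_smul, hP, hQ,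
      Matrix.conjTranspose_one, Complex.star_def, Complex.conj_ofReal]
  have hZ : Z.conjTranspose = (a : ℂ) • (P * Q) - (b : ℂ) • Q := by
    simp only [Z, Matrix.conjTranspose_sub, Matrix.conjTranspose_smul, Matrix.conjTranspose_mul,
      hP, hQ, Complex.star_def, Complex.conj_ofReal]
  have hPQQ : P * Q * Q = (δ : ℂ) • (P * Q) := by rw [mul_assoc, hQQ, mul_smul_comm]
  have hQQP : Q * (Q * P) = (δ : ℂ) • (Q * P) := by rw [← mul_assoc, hQQ, smul_mul_assoc]
  have hPQQP : P * Q * (Q * P) = (δ : ℂ) • P := by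
    rw [← mul_assoc, hPQQ, smul_mul_assoc, hPQP]
  have hXX : X * X = ((a * b) ^ 2 : ℂ) • 1 - (2 * a * b * (y * a) : ℂ) • P
      - (2 * a * b * (x * b) : ℂ) • Q + ((y * a) ^ 2 * δ : ℂ) • P + ((x * b) ^ 2 * δ : ℂ) • Q
      + (x * y * a * b : ℂ) • (P * Q) + (x * y * a * b : ℂ) • (Q * P) := by
    simp only [X, mul_sub, sub_mul, smul_mul_assoc, mul_smul_comm, one_mul, mul_one, hPP, hQQ,
      smul_sub, smul_smul]
    push_cast
    module
  have hZZ : Z.conjTranspose * Z = (a ^ 2 * δ : ℂ) • P + (b ^ 2 * δ : ℂ) • Q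
      - (a * b * δ : ℂ) • (P * Q) - (a * b * δ : ℂ) • (Q * P) := by
    rw [hZ]
    simp only [Z, mul_sub, sub_mul, smul_mul_assoc, mul_smul_comm, hQQ, hPQQ, hQQP, hPQQP,
      smul_sub, smul_smul]
    module
  have key : ((a * b : ℝ) : ℂ) • X =
      X.conjTranspose * X + ((x * y / δ : ℝ) : ℂ) • (Z.conjTranspose * Z) := by
    have hδ' : (δ : ℂ) ≠ 0 := by exact_mod_cast hδ.ne'
    have h1 : (a : ℂ) * (b - y * δ) = a * x := by rw [hb]; push_cast; ring
    have h2 : (b : ℂ) * (a - x * δ) = b * y := by rw [ha]; push_cast; ring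
    rw [hX, hXX, hZZ]
    simp only [X, smul_sub, smul_add, smul_smul]
    push_cast
    have e1 : (x * y / δ * (a ^ 2 * δ) : ℂ) = (y * a) * (a * b) - (y * a) ^ 2 * δ := by
      field_simp
      linear_combination (-y * a : ℂ) * h1
    have e2 : (x * y / δ * (b ^ 2 * δ) : ℂ) = (x * b) * (a * b) - (x * b) ^ 2 * δ := by
      field_simp
      linear_combination (-x * b : ℂ) * h2
    have e3 : (x * y / δ * (a * b * δ) : ℂ) = x * y * a * b := by
      field_simp
    rw [e1, e2, e3]
    module
  have hpos : 0 ≤ a * b * (R * X).trace.re := by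
    have h1 := re_trace_mul_conjTranspose_mul_nonneg hR X
    have h2 := re_trace_mul_conjTranspose_mul_nonneg hR Z
    have h3 := congrArg (fun M => (R * M).trace.re) key
    simp only [mul_smul_comm, mul_add, Matrix.trace_add, Matrix.trace_smul, smul_eq_mul,
      Complex.add_re, Complex.re_ofReal_mul] at h3
    rw [h3]
    have : 0 ≤ x * y / δ := by positivity
    positivity
  have hXtr : (R * X).trace.re = a * b * R.trace.re - y * a * (R * P).trace.re -
      x * b * (R * Q).trace.re := by
    simp only [X, mul_sub, mul_smul_comm, Matrix.trace_sub, Matrix.trace_smul, smul_eq_mul,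
      Complex.sub_re, Complex.re_ofReal_mul, mul_one]
  rcases (mul_nonneg ha0 hb0).eq_or_lt with h0 | h0
  · -- `a b = 0` forces `x = y = 0`
    have : x = 0 ∧ y = 0 := by
      rcases mul_eq_zero.1 h0.symm with h | h
      · have h1 := (add_eq_zero_iff_of_nonneg (mul_nonneg hδ.le hx) hy).1 h
        exact ⟨(mul_eq_zero.1 h1.1).resolve_left hδ.ne', h1.2⟩
      · have h1 := (add_eq_zero_iff_of_nonneg (mul_nonneg hδ.le hy) hx).1 h
        exact ⟨h1.2, (mul_eq_zero.1 h1.1).resolve_left hδ.ne'⟩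
    simp [ha, hb, this.1, this.2]
  · have := nonneg_of_mul_nonneg_right hpos h0
    linarith

/-! ### The operators that express gain and fidelity -/

/-- `|I⟩⟩⟨⟨I|` on the wires `3, 2`, tensored with the identity. -/
def bell32 (d : ℕ) : Matrix (Wires d) (Wires d) ℂ := Matrix.of fun a b =>
  (1 : Matrix (Fin d) (Fin d) ℂ) a.1 a.2.1 * (1 : Matrix (Fin d) (Fin d) ℂ) b.1 b.2.1 *
    ((1 : Matrix (Fin d) (Fin d) ℂ) a.2.2.1 b.2.2.1 *
      (1 : Matrix (Fin d) (Fin d) ℂ) a.2.2.2 b.2.2.2)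

/-- `|I⟩⟩⟨⟨I|` on the wires `1, 0`, tensored with the identity. -/
def bell10 (d : ℕ) : Matrix (Wires d) (Wires d) ℂ := Matrix.of fun a b =>
  (1 : Matrix (Fin d) (Fin d) ℂ) a.1 b.1 * (1 : Matrix (Fin d) (Fin d) ℂ) a.2.1 b.2.1 *
    ((1 : Matrix (Fin d) (Fin d) ℂ) a.2.2.1 a.2.2.2 *
      (1 : Matrix (Fin d) (Fin d) ℂ) b.2.2.1 b.2.2.2)

/-- `|U*⟩⟩⟨⟨U*|` on the wires `2, 1`, tensored with the identity. -/
def choi21 {d : ℕ} (U : SU d) : Matrix (Wires d) (Wires d) ℂ := Matrix.of fun a b =>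
  (1 : Matrix (Fin d) (Fin d) ℂ) a.1 b.1 * (1 : Matrix (Fin d) (Fin d) ℂ) a.2.2.2 b.2.2.2 *
    (U.1 b.2.1 b.2.2.1 * star (U.1 a.2.1 a.2.2.1))

theorem sum_sum_mul_star_SU {d : ℕ} (U : SU d) :
    ∑ i, ∑ j, U.1 i j * star (U.1 i j) = d := by
  simp only [sum_mul_star_SU]
  simp

theorem bell32_conjTranspose (d : ℕ) : (bell32 d).conjTranspose = bell32 d := by
  ext a b
  simp only [bell32, Matrix.conjTranspose_apply, Matrix.of_apply, Matrix.one_apply]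
  simp only [star_mul', apply_ite star, star_one, star_zero, eq_comm (a := b.2.2.1),
    eq_comm (a := b.2.2.2)]
  ring

theorem bell10_conjTranspose (d : ℕ) : (bell10 d).conjTranspose = bell10 d := by
  ext a b
  simp only [bell10, Matrix.conjTranspose_apply, Matrix.of_apply, Matrix.one_apply]
  simp only [star_mul', apply_ite star, star_one, star_zero, eq_comm (a := b.1),
    eq_comm (a := b.2.1)]
  ring

theorem choi21_conjTranspose {d : ℕ} (U : SU d) : (choi21 U).conjTranspose = choi21 U := by
  ext a b
  simp only [choi21, Matrix.conjTranspose_apply, Matrix.of_apply, Matrix.one_apply]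
  simp only [star_mul', apply_ite star, star_one, star_zero, eq_comm (a := b.1),
    eq_comm (a := b.2.2.2), star_star]
  ring

theorem bell32_mul_self (d : ℕ) : bell32 d * bell32 d = (d : ℂ) • bell32 d := by
  ext a b
  simp only [bell32, Matrix.mul_apply, Matrix.of_apply, Matrix.one_apply, Matrix.smul_apply,
    Fintype.sum_prod_type, smul_eq_mul]
  simp
  split_ifs <;> rfl

theorem bell10_mul_self (d : ℕ) : bell10 d * bell10 d = (d : ℂ) • bell10 d := by
  ext a b
  simp only [bell10, Matrix.mul_apply, Matrix.of_apply, Matrix.one_apply, Matrix.smul_apply,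
    Fintype.sum_prod_type, smul_eq_mul]
  simp
  split_ifs <;> simp

theorem bell32_mul_bell10_apply (d : ℕ) (a b : Wires d) : (bell32 d * bell10 d) a b =
    (1 : Matrix (Fin d) (Fin d) ℂ) a.1 a.2.1 * (1 : Matrix (Fin d) (Fin d) ℂ) b.1 b.2.1 *
    ((1 : Matrix (Fin d) (Fin d) ℂ) a.2.2.1 a.2.2.2 *
      (1 : Matrix (Fin d) (Fin d) ℂ) b.2.2.1 b.2.2.2) := by
  simp only [bell32, bell10, Matrix.mul_apply, Matrix.of_apply, Matrix.one_apply,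
    Fintype.sum_prod_type]
  simp

theorem bell10_mul_bell32 (d : ℕ) : bell10 d * bell32 d = bell32 d * bell10 d := by
  ext a b
  rw [bell32_mul_bell10_apply]
  simp only [bell32, bell10, Matrix.mul_apply, Matrix.of_apply, Matrix.one_apply,
    Fintype.sum_prod_type]
  simp
  split_ifs <;> rfl

theorem choi21_mul_self {d : ℕ} (U : SU d) : choi21 U * choi21 U = (d : ℂ) • choi21 U := by
  ext a b
  simp only [choi21, Matrix.mul_apply, Matrix.of_apply, Matrix.one_apply, Matrix.smul_apply,
    Fintype.sum_prod_type, smul_eq_mul]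
  have h : ∑ x, ∑ y, U.1 x y * star (U.1 a.2.1 a.2.2.1) *
      (U.1 b.2.1 b.2.2.1 * star (U.1 x y)) =
      d * (U.1 b.2.1 b.2.2.1 * star (U.1 a.2.1 a.2.2.1)) := by
    rw [← sum_sum_mul_star_SU U, Finset.sum_mul]
    refine Finset.sum_congr rfl fun x _ => ?_
    rw [Finset.sum_mul]
    exact Finset.sum_congr rfl fun y _ => by ring
  simp only [Complex.star_def] at h
  simp [h]

theorem bell32_mul_choi21_mul_bell32 {d : ℕ} (U : SU d) :
    bell32 d * choi21 U * bell32 d = bell32 d := by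
  ext a b
  simp only [bell32, choi21, Matrix.mul_apply, Matrix.of_apply, Matrix.one_apply,
    Fintype.sum_prod_type]
  have h : ∑ x, U.1 x b.2.2.1 * star (U.1 x a.2.2.1) =
      if a.2.2.1 = b.2.2.1 then 1 else 0 := by
    rw [← sum_star_mul_SU U]
    exact Finset.sum_congr rfl fun x _ => mul_comm _ _
  simp only [Complex.star_def] at h
  simp [h]
  split_ifs <;> rfl

/-! ### Fidelity and gain as traces -/

theorem sum_wires {d : ℕ} {M : Type*} [AddCommMonoid M] (f : Wires d → M) :
    ∑ a, f a = ∑ a : Fin d × Fin d, ∑ s : Fin d × Fin d, f (a.1, s.1, s.2, a.2) := by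
  rw [← Fintype.sum_prod_type']
  exact Fintype.sum_equiv
    { toFun := fun a : Wires d => ((a.1, a.2.2.2), (a.2.1, a.2.2.1))
      invFun := fun p => (p.1.1, p.2.1, p.2.2, p.1.2)
      left_inv := fun _ => rfl
      right_inv := fun _ => rfl } _ _ fun _ => rfl

theorem choi_unitaryChannel_apply {d : ℕ} (U : SU d) (s t : Fin d × Fin d) :
    choi (unitaryChannel U) s t = U.1 s.1 s.2 * star (U.1 t.1 t.2) := by
  simp [choi, unitaryChannel, Matrix.mul_apply, Matrix.single_apply, Matrix.star_apply, ite_and]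

/-- The rank-one operator of the vector `|U⟩⟩₃₀ |U*⟩⟩₂₁`. -/
def choiPair {d : ℕ} (U : SU d) : Matrix (Wires d) (Wires d) ℂ := Matrix.of fun a b =>
  U.1 a.1 a.2.2.2 * star (U.1 a.2.1 a.2.2.1) * (U.1 b.2.1 b.2.2.1 * star (U.1 b.1 b.2.2.2))

theorem channelFidelity_link {d : ℕ} (S : Matrix (Wires d) (Wires d) ℂ) (U : SU d) :
    channelFidelity (link S (choi (unitaryChannel U))) U =
      (S * choiPair U).trace.re / (d : ℝ) ^ 2 := by
  have h : star (dket U.1) ⬝ᵥ (link S (choi (unitaryChannel U))).mulVec (dket U.1) =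
      (S * choiPair U).trace := by
    simp only [Matrix.trace, Matrix.diag, Matrix.mul_apply, sum_wires, dotProduct, Matrix.mulVec,
      link, Matrix.of_apply, Matrix.transpose_apply, choi_unitaryChannel_apply, choiPair, dket,
      Pi.star_apply, Finset.mul_sum, Finset.sum_mul]
    refine Finset.sum_congr rfl fun a _ => ?_
    rw [Finset.sum_comm]
    refine Finset.sum_congr rfl fun s _ => ?_
    refine Finset.sum_congr rfl fun b _ => ?_
    refine Finset.sum_congr rfl fun t _ => ?_
    ring
  rw [channelFidelity, h]

theorem outcomeProb_maxMixed {d : ℕ} (S : Matrix (Wires d) (Wires d) ℂ) (U : SU d) :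
    outcomeProb S U ((d : ℂ)⁻¹ • 1) = (S * choi21 U).trace.re / d := by
  have h : (applyChoi (link S (choi (unitaryChannel U))) ((d : ℂ)⁻¹ • 1)).trace =
      (S * choi21 U).trace * ((d⁻¹ : ℝ) : ℂ) := by
    simp only [Matrix.trace, Matrix.diag, Matrix.mul_apply, sum_wires, applyChoi,
      link, Matrix.of_apply, Matrix.transpose_apply, choi_unitaryChannel_apply, choi21,
      Matrix.smul_apply, smul_eq_mul]
    rw [Finset.sum_mul, Fintype.sum_prod_type]
    refine Finset.sum_congr rfl fun i _ => Finset.sum_congr rfl fun m _ => ?_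
    rw [Finset.sum_eq_single m (fun n _ hn => by simp [Ne.symm hn])
      (fun hm => absurd (Finset.mem_univ m) hm)]
    simp only [Matrix.one_apply_eq, mul_one]
    congr 1
    · refine Finset.sum_congr rfl fun s _ => ?_
      symm
      rw [Finset.sum_eq_single (i, m) ?_ (fun hm => absurd (Finset.mem_univ _) hm)]
      · simp
      · rintro ⟨j, n⟩ - hb
        have : i ≠ j ∨ m ≠ n := by
          by_contra hcon
          push Not at hcon
          exact hb (by rw [hcon.1, hcon.2])
        rcases this with hne | hne <;> simp [Matrix.one_apply, Ne.symm hne]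
    · push_cast; rfl
  rw [outcomeProb, h, mul_comm, Complex.re_ofReal_mul, div_eq_inv_mul]

theorem integrable_trace {d : ℕ} {R K : SU d → Matrix (Wires d) (Wires d) ℂ}
    (h : ∀ a b, Integrable (fun V => R V a b * K V b a) (haarSU d)) :
    Integrable (fun V => (R V * K V).trace) (haarSU d) := by
  simp only [Matrix.trace, Matrix.diag, Matrix.mul_apply]
  exact integrable_finsetSum _ fun a _ => integrable_finsetSum _ fun b _ => h a b

theorem integral_re_trace {d : ℕ} {R K : SU d → Matrix (Wires d) (Wires d) ℂ}
    (h : ∀ a b, Integrable (fun V => R V a b * K V b a) (haarSU d)) :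
    ∫ V, (R V * K V).trace.re ∂(haarSU d) =
      (∑ a, ∑ b, ∫ V, R V a b * K V b a ∂(haarSU d)).re := by
  have e : ∫ V, (R V * K V).trace ∂(haarSU d) =
      ∑ a, ∑ b, ∫ V, R V a b * K V b a ∂(haarSU d) := by
    simp only [Matrix.trace, Matrix.diag, Matrix.mul_apply]
    rw [integral_finsetSum _ fun a _ => integrable_finsetSum _ fun b _ => h a b]
    exact Finset.sum_congr rfl fun a _ => integral_finsetSum _ fun b _ => h a b
  rw [← e]
  exact integral_re (integrable_trace h)

theorem integral_re_trace_mul_const {d : ℕ} {R : SU d → Matrix (Wires d) (Wires d) ℂ}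
    (h : ∀ a b, Integrable (fun V => R V a b) (haarSU d)) (M : Matrix (Wires d) (Wires d) ℂ) :
    ∫ V, (R V * M).trace.re ∂(haarSU d) = (integralSU R * M).trace.re := by
  rw [integral_re_trace (K := fun _ => M) fun a b => (h a b).mul_const _]
  simp only [integral_mul_const]
  rfl

theorem integral_re_trace_const_mul {d : ℕ} {K : SU d → Matrix (Wires d) (Wires d) ℂ}
    (h : ∀ a b, Integrable (fun V => K V a b) (haarSU d)) (M : Matrix (Wires d) (Wires d) ℂ) :
    ∫ V, (M * K V).trace.re ∂(haarSU d) = (M * integralSU K).trace.re := by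
  rw [integral_re_trace (R := fun _ => M) fun a b => (h b a).const_mul _]
  simp only [integral_const_mul]
  rfl

theorem integrable_mul_continuous {d : ℕ} {f g : SU d → ℂ} (hf : Integrable f (haarSU d))
    (hg : Continuous g) : Integrable (fun V => f V * g V) (haarSU d) := by
  obtain ⟨C, hC⟩ := isCompact_univ.exists_bound_of_continuousOn hg.continuousOn
  exact hf.mul_bdd hg.aestronglyMeasurable (Filter.Eventually.of_forall fun V => hC V trivial)

theorem continuous_choi21_apply {d : ℕ} (a b : Wires d) :
    Continuous fun U : SU d => choi21 U a b := by
  simp only [choi21, Matrix.of_apply]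
  exact continuous_const.mul ((continuous_coe_apply _ _).mul (continuous_coe_apply _ _).star)

theorem continuous_choiPair_apply {d : ℕ} (a b : Wires d) :
    Continuous fun U : SU d => choiPair U a b := by
  simp only [choiPair, Matrix.of_apply]
  exact ((continuous_coe_apply _ _).mul (continuous_coe_apply _ _).star).mul
    ((continuous_coe_apply _ _).mul (continuous_coe_apply _ _).star)

/-- The twirl of `|I⟩⟩₃₀ |I⟩⟩₂₁`: with `P = |I⟩⟩⟨⟨I|₃₂ / d` and `P' = |I⟩⟩⟨⟨I|₁₀ / d` it is
`P P' + (1 - P)(1 - P') / (d² - 1)`. -/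
theorem integralSU_choiPair {d : ℕ} (hd : 2 ≤ d) : integralSU (choiPair (d := d)) =
    ((d : ℂ) ^ 2 - 1)⁻¹ • (1 - (d : ℂ)⁻¹ • bell32 d - (d : ℂ)⁻¹ • bell10 d +
      bell32 d * bell10 d) := by
  ext a b
  simp only [integralSU, choiPair, Matrix.of_apply, integral_four hd, Matrix.smul_apply,
    Matrix.add_apply, Matrix.sub_apply, bell32_mul_bell10_apply, smul_eq_mul]
  rw [show (1 : Matrix (Wires d) (Wires d) ℂ) a b =
    (1 : Matrix (Fin d) (Fin d) ℂ) a.1 b.1 * (1 : Matrix (Fin d) (Fin d) ℂ) a.2.1 b.2.1 *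
    ((1 : Matrix (Fin d) (Fin d) ℂ) a.2.2.1 b.2.2.1 *
      (1 : Matrix (Fin d) (Fin d) ℂ) a.2.2.2 b.2.2.2) by
    simp only [Matrix.one_apply, Prod.ext_iff, ite_and]
    split_ifs <;> simp]
  simp only [bell32, bell10, Matrix.of_apply]
  simp only [Matrix.one_apply, eq_comm (a := b.2.1) (b := b.1),
    eq_comm (a := a.2.2.2) (b := a.2.2.1), eq_comm (a := b.2.2.1) (b := a.2.2.1)]
  ring

theorem fidelity_eq {d : ℕ} (hd : 2 ≤ d) {R : SU d → Matrix (Wires d) (Wires d) ℂ}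
    (h : ∀ a b, Integrable (fun V => R V a b) (haarSU d)) :
    fidelity R = ((integralSU R).trace.re - (integralSU R * bell32 d).trace.re / d -
      (integralSU R * bell10 d).trace.re / d +
      (integralSU R * (bell32 d * bell10 d)).trace.re) /
      ((d : ℝ) ^ 2 * ((d : ℝ) ^ 2 - 1)) := by
  simp only [fidelity, channelFidelity_link, integral_div, integral_re_trace_mul_const h]
  rw [integral_re_trace_const_mul fun a b => integrable_of_continuous (continuous_choiPair_apply a b),
    integralSU_choiPair hd]
  have h1 : ((d : ℂ) ^ 2 - 1)⁻¹ = ((((d : ℝ) ^ 2 - 1)⁻¹ : ℝ) : ℂ) := by push_cast; rfl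
  have h2 : (d : ℂ)⁻¹ = (((d : ℝ)⁻¹ : ℝ) : ℂ) := by push_cast; rfl
  have h3 : ∀ M : Matrix (Wires d) (Wires d) ℂ,
      (M * (((d : ℂ) ^ 2 - 1)⁻¹ • (1 - (d : ℂ)⁻¹ • bell32 d - (d : ℂ)⁻¹ • bell10 d +
        bell32 d * bell10 d))).trace.re = ((d : ℝ) ^ 2 - 1)⁻¹ * (M.trace.re -
        (d : ℝ)⁻¹ * (M * bell32 d).trace.re - (d : ℝ)⁻¹ * (M * bell10 d).trace.re +
        (M * (bell32 d * bell10 d)).trace.re) := by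
    intro M
    rw [h1, h2]
    simp only [mul_smul_comm, mul_add, mul_sub M, mul_one, Matrix.trace_smul, Matrix.trace_add,
      Matrix.trace_sub, smul_eq_mul, Complex.re_ofReal_mul, Complex.add_re, Complex.sub_re]
  rw [h3, div_eq_mul_inv _ ((d : ℝ) ^ 2 * _), mul_inv]
  ring

/-- Averaging `|U*⟩⟩⟨⟨U*|` over `U` with weight `|Tr[V U†]|²` gives a combination of the identity and
`|V*⟩⟩⟨⟨V*|`. -/
theorem integral_choi21_mul_guess {d : ℕ} (hd : 2 ≤ d) (V : SU d) (a b : Wires d) :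
    ∫ U, choi21 U a b * ((V.1 * star U.1).trace * star (V.1 * star U.1).trace) ∂(haarSU d) =
      ((d : ℂ) ^ 2 - 1)⁻¹ * ((d - 2 / d) * (1 : Matrix (Wires d) (Wires d) ℂ) a b +
        choi21 V a b) := by
  have hexp : ∀ U : SU d,
      choi21 U a b * ((V.1 * star U.1).trace * star (V.1 * star U.1).trace) =
      ∑ i, ∑ j, ∑ k, ∑ l, (1 : Matrix (Fin d) (Fin d) ℂ) a.1 b.1 *
        (1 : Matrix (Fin d) (Fin d) ℂ) a.2.2.2 b.2.2.2 * (V.1 k l * star (V.1 i j)) *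
        (U.1 b.2.1 b.2.2.1 * star (U.1 a.2.1 a.2.2.1) * (U.1 i j * star (U.1 k l))) := by
    intro U
    have htr : (V.1 * star U.1).trace = ∑ i, ∑ j, V.1 i j * star (U.1 i j) := by
      simp only [Matrix.trace, Matrix.diag, Matrix.mul_apply, Matrix.star_apply]
    rw [htr]
    simp only [choi21, Matrix.of_apply, star_sum, star_mul', star_star, Finset.sum_mul,
      Finset.mul_sum]
    refine Finset.sum_congr rfl fun i _ => Finset.sum_congr rfl fun j _ =>
      Finset.sum_congr rfl fun k _ => Finset.sum_congr rfl fun l _ => ?_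
    ring
  have hint : ∀ i j k l, Integrable (fun U : SU d => (1 : Matrix (Fin d) (Fin d) ℂ) a.1 b.1 *
        (1 : Matrix (Fin d) (Fin d) ℂ) a.2.2.2 b.2.2.2 * (V.1 k l * star (V.1 i j)) *
        (U.1 b.2.1 b.2.2.1 * star (U.1 a.2.1 a.2.2.1) * (U.1 i j * star (U.1 k l))))
      (haarSU d) := fun i j k l => integrable_of_continuous <| continuous_const.mul
    (((continuous_coe_apply _ _).mul (continuous_coe_apply _ _).star).mul
      ((continuous_coe_apply _ _).mul (continuous_coe_apply _ _).star))
  simp only [hexp]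
  rw [integral_finsetSum _ fun i _ => integrable_finsetSum _ fun j _ =>
    integrable_finsetSum _ fun k _ => integrable_finsetSum _ fun l _ => hint i j k l]
  simp_rw [integral_finsetSum _ fun j _ =>
    integrable_finsetSum _ fun k _ => integrable_finsetSum _ fun l _ => hint _ j k l,
    integral_finsetSum _ fun k _ => integrable_finsetSum _ fun l _ => hint _ _ k l,
    integral_finsetSum _ fun l _ => hint _ _ _ l, integral_const_mul, integral_four hd]
  have hone : (1 : Matrix (Wires d) (Wires d) ℂ) a b =
      (1 : Matrix (Fin d) (Fin d) ℂ) a.1 b.1 * (1 : Matrix (Fin d) (Fin d) ℂ) a.2.1 b.2.1 *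
      ((1 : Matrix (Fin d) (Fin d) ℂ) a.2.2.1 b.2.2.1 *
        (1 : Matrix (Fin d) (Fin d) ℂ) a.2.2.2 b.2.2.2) := by
    simp only [Matrix.one_apply, Prod.ext_iff, ite_and]
    split_ifs <;> simp
  rw [hone]
  simp only [choi21, Matrix.of_apply, Matrix.one_apply]
  have s1 := sum_sum_mul_star_SU V
  have s2 : ∑ x, V.1 x b.2.2.1 * star (V.1 x a.2.2.1) =
      if a.2.2.1 = b.2.2.1 then 1 else 0 := by
    rw [← sum_star_mul_SU V]
    exact Finset.sum_congr rfl fun x _ => mul_comm _ _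
  have s3 := sum_mul_star_SU V b.2.1 a.2.1
  simp only [Complex.star_def] at s1 s2 s3
  simp [mul_add, mul_sub, Finset.sum_add_distrib, Finset.sum_sub_distrib, ite_div]
  simp only [← Finset.sum_mul, s1, s2, s3, eq_comm (a := b.2.1), eq_comm (a := b.2.2.1)]
  split_ifs <;> first | rfl | (simp; done) | (field_simp; ring)

/-- The average gain; the integral over the black box is done first, for a fixed outcome. -/
theorem gain_eq {d : ℕ} (hd : 2 ≤ d) {R : SU d → Matrix (Wires d) (Wires d) ℂ}
    (h : ∀ a b, Integrable (fun V => R V a b) (haarSU d)) :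
    gain R = (((d : ℝ) - 2 / d) * (integralSU R).trace.re +
      ∫ V, (R V * choi21 V).trace.re ∂(haarSU d)) /
      ((d : ℝ) ^ 3 * ((d : ℝ) ^ 2 - 1)) := by
  have hd0 : (d : ℝ) ≠ 0 := by exact_mod_cast (by omega : d ≠ 0)
  let f : SU d → SU d → ℂ := fun U V => (R V * choi21 U).trace *
    ((V.1 * star U.1).trace * star (V.1 * star U.1).trace)
  have hf : ∀ U V, outcomeProb (R V) U ((d : ℂ)⁻¹ • 1) * guessFidelity V U =
      (f U V).re / (d : ℝ) ^ 3 := by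
    intro U V
    have hz : (V.1 * star U.1).trace * star (V.1 * star U.1).trace =
        ((‖(V.1 * star U.1).trace‖ ^ 2 : ℝ) : ℂ) := by
      rw [Complex.star_def, Complex.mul_conj']; push_cast; rfl
    simp only [f]
    rw [outcomeProb_maxMixed, guessFidelity, hz, mul_comm, mul_comm _ (Complex.ofReal _),
      Complex.re_ofReal_mul]
    field_simp
  have hfi : Integrable (Function.uncurry f) ((haarSU d).prod (haarSU d)) := by
    have : Function.uncurry f = fun p : SU d × SU d => ∑ a, ∑ b, R p.2 a b *
        (choi21 p.1 b a * ((p.2.1 * star p.1.1).trace * star (p.2.1 * star p.1.1).trace)) := by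
      funext p
      have ht : (R p.2 * choi21 p.1).trace = ∑ a, ∑ b, R p.2 a b * choi21 p.1 b a := by
        simp only [Matrix.trace, Matrix.diag, Matrix.mul_apply]
      simp only [Function.uncurry, f, ht, Finset.sum_mul, mul_assoc]
    rw [this]
    refine integrable_finsetSum _ fun a _ => integrable_finsetSum _ fun b _ => ?_
    have hc : Continuous fun p : SU d × SU d => choi21 p.1 b a *
        ((p.2.1 * star p.1.1).trace * star (p.2.1 * star p.1.1).trace) := by
      refine ((continuous_choi21_apply b a).comp continuous_fst).mul ?_
      have : Continuous fun p : SU d × SU d => (p.2.1 * star p.1.1).trace :=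
        Continuous.matrix_trace (by fun_prop)
      exact this.mul this.star
    obtain ⟨C, hC⟩ := isCompact_univ.exists_bound_of_continuousOn hc.continuousOn
    exact ((h a b).comp_snd _).mul_bdd hc.aestronglyMeasurable
      (Filter.Eventually.of_forall fun p => hC p trivial)
  have hinner : ∀ V, ∫ U, (f U V).re ∂(haarSU d) = ((d : ℝ) ^ 2 - 1)⁻¹ *
      (((d : ℝ) - 2 / d) * (R V).trace.re + (R V * choi21 V).trace.re) := by
    intro V
    let K : SU d → Matrix (Wires d) (Wires d) ℂ := fun U =>
      ((V.1 * star U.1).trace * star (V.1 * star U.1).trace) • choi21 U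
    have hK : ∀ a b, Integrable (fun U => K U a b) (haarSU d) := fun a b => by
      refine integrable_of_continuous (Continuous.mul ?_ (continuous_choi21_apply a b))
      have : Continuous fun U : SU d => (V.1 * star U.1).trace :=
        Continuous.matrix_trace (by fun_prop)
      exact this.mul this.star
    have hKint : integralSU K = (((((d : ℝ) ^ 2 - 1)⁻¹ : ℝ) : ℂ)) •
        ((((d : ℝ) - 2 / d : ℝ) : ℂ) • 1 + choi21 V) := by
      ext a b
      simp only [integralSU, K, Matrix.of_apply, Matrix.smul_apply, smul_eq_mul,
        Matrix.add_apply]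
      simp only [mul_comm _ (choi21 _ a b)]
      rw [integral_choi21_mul_guess hd]
      push_cast
      rfl
    have hfK : ∀ U, f U V = (R V * K U).trace := by
      intro U
      simp only [f, K, mul_smul_comm, Matrix.trace_smul, smul_eq_mul]
      rw [mul_comm]
    simp only [hfK]
    rw [integral_re_trace_const_mul hK, hKint]
    simp only [mul_smul_comm, mul_add, mul_one, Matrix.trace_smul, Matrix.trace_add, smul_eq_mul,
      Complex.re_ofReal_mul, Complex.add_re]
  simp only [gain, gainOf, hf, integral_div]
  rw [integral_integral_swap (f := fun U V => (f U V).re) hfi.re]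
  simp only [hinner]
  have hi1 : Integrable (fun V => (R V).trace.re) (haarSU d) :=
    (integrable_finsetSum _ fun a _ => h a a : Integrable (fun V => (R V).trace) (haarSU d)).re
  have hi2 : Integrable (fun V => (R V * choi21 V).trace.re) (haarSU d) :=
    (integrable_trace fun a b => integrable_mul_continuous (h a b) (continuous_choi21_apply b a)).re
  have h1 : ∫ V, (R V).trace.re ∂(haarSU d) = (integralSU R).trace.re := by
    simpa using integral_re_trace_mul_const h 1
  rw [integral_const_mul, integral_add (hi1.const_mul _) hi2, integral_const_mul, h1]
  rw [div_eq_mul_inv, div_eq_mul_inv _ ((d : ℝ) ^ 3 * _), mul_inv]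
  ring

/-! ### The trade-off inequality -/

theorem trace_traceFirst {d : ℕ} {n : Type} [Fintype n]
    (M : Matrix (Fin d × n) (Fin d × n) ℂ) : (traceFirst M).trace = M.trace := by
  simp only [Matrix.trace, Matrix.diag, traceFirst, Matrix.of_apply, Fintype.sum_prod_type]
  exact Finset.sum_comm

theorem IsDetComb.trace_eq {d : ℕ} {R : Matrix (Wires d) (Wires d) ℂ} (h : IsDetComb R) :
    R.trace = (d : ℂ) ^ 2 := by
  obtain ⟨-, R₁, -, h1, h2⟩ := h
  rw [← trace_traceFirst, h1, Matrix.trace_kronecker, ← trace_traceFirst R₁, h2]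
  simp [sq]

theorem IsInstrument.re_trace_eq {d : ℕ} {R : SU d → Matrix (Wires d) (Wires d) ℂ}
    (h : IsInstrument R) : (integralSU R).trace.re = (d : ℝ) ^ 2 := by
  rw [h.isDetComb.trace_eq]
  exact_mod_cast Complex.ofReal_re ((d : ℝ) ^ 2)

/-- For commuting `P` and `Q` that are `δ` times projections, `P Q ≤ δ P`. -/
theorem re_trace_mul_le_of_commute {n : Type*} [Fintype n] {P Q R : Matrix n n ℂ} {δ : ℝ}
    (hδ : 0 < δ) (hP : P.conjTranspose = P) (hQ : Q.conjTranspose = Q)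
    (hPP : P * P = (δ : ℂ) • P) (hQQ : Q * Q = (δ : ℂ) • Q) (hPQ : Q * P = P * Q)
    (hR : R.PosSemidef) : (R * (P * Q)).trace.re ≤ δ * (R * P).trace.re := by
  let Y : Matrix n n ℂ := (δ : ℂ) • P - P * Q
  have hY : Y.conjTranspose = Y := by
    simp only [Y, Matrix.conjTranspose_sub, Matrix.conjTranspose_smul, Matrix.conjTranspose_mul,
      hP, hQ, Complex.star_def, Complex.conj_ofReal, hPQ]
  have h1 : P * (P * Q) = (δ : ℂ) • (P * Q) := by rw [← mul_assoc, hPP, smul_mul_assoc]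
  have h2 : P * Q * P = (δ : ℂ) • (P * Q) := by rw [mul_assoc, hPQ, h1]
  have h3 : P * Q * (P * Q) = ((δ ^ 2 : ℝ) : ℂ) • (P * Q) := by
    rw [← mul_assoc, h2, smul_mul_assoc, mul_assoc, hQQ, mul_smul_comm, smul_smul]
    push_cast; rw [sq]
  have key : Y.conjTranspose * Y = ((δ ^ 2 : ℝ) : ℂ) • Y := by
    rw [hY]
    simp only [Y, mul_sub, sub_mul, smul_mul_assoc, mul_smul_comm, h1, h2, h3, hPP]
    push_cast
    module
  have h4 := re_trace_mul_conjTranspose_mul_nonneg hR Y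
  rw [key, mul_smul_comm, Matrix.trace_smul, smul_eq_mul, Complex.re_ofReal_mul] at h4
  have h5 := nonneg_of_mul_nonneg_right h4 (by positivity)
  simp only [Y, mul_sub, mul_smul_comm, Matrix.trace_sub, Matrix.trace_smul, smul_eq_mul,
    Complex.sub_re, Complex.re_ofReal_mul] at h5
  linarith

theorem information_eq {d : ℕ} (hd : 2 ≤ d) {R : SU d → Matrix (Wires d) (Wires d) ℂ}
    (h : IsInstrument R) : information R =
      1 - ((d : ℝ) ^ 3 - ∫ V, (R V * choi21 V).trace.re ∂(haarSU d)) /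
        (d * ((d : ℝ) ^ 2 - 1)) := by
  have hd2 : (2 : ℝ) ≤ d := by exact_mod_cast hd
  have hd1 : (d : ℝ) ^ 2 - 1 ≠ 0 := by nlinarith
  rw [information, gain_eq hd h.integrable, h.re_trace_eq]
  field_simp
  ring

/-- The disturbance is at least the normalized weight of the comb outside `|I⟩⟩⟨⟨I|` on the wires
`3, 2`. -/
theorem le_disturbance {d : ℕ} (hd : 2 ≤ d) {R : SU d → Matrix (Wires d) (Wires d) ℂ}
    (h : IsInstrument R) : ((d : ℝ) ^ 3 - (integralSU R * bell32 d).trace.re) /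
        (d * ((d : ℝ) ^ 2 - 1)) ≤ disturbance R := by
  have hd2 : (2 : ℝ) ≤ d := by exact_mod_cast hd
  have hd0 : (0 : ℝ) < d := by linarith
  have hd1 : 0 < (d : ℝ) ^ 2 - 1 := by nlinarith
  have hd3 : 0 < (d : ℝ) ^ 2 - 2 := by nlinarith
  have h1 := re_trace_mul_le_of_commute hd0 (bell32_conjTranspose d) (bell10_conjTranspose d)
    (by simpa using bell32_mul_self d) (by simpa using bell10_mul_self d)
    (bell10_mul_bell32 d) h.isDetComb.1
  have h2 := re_trace_mul_le_of_commute hd0 (bell10_conjTranspose d) (bell32_conjTranspose d)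
    (by simpa using bell10_mul_self d) (by simpa using bell32_mul_self d)
    (bell10_mul_bell32 d).symm h.isDetComb.1
  rw [bell10_mul_bell32] at h2
  rw [disturbance, fidelity_eq hd h.integrable, h.re_trace_eq]
  set e := (integralSU R * bell32 d).trace.re
  set e' := (integralSU R * bell10 d).trace.re
  set E := (integralSU R * (bell32 d * bell10 d)).trace.re
  have h3 : E - e' / d ≤ ((d : ℝ) ^ 2 - 1) * (e / d) := by
    have e1 : E / (d : ℝ) ^ 2 ≤ e' / d := by
      rw [div_le_div_iff₀ (by positivity) hd0]; nlinarith
    have e2 : E / (d : ℝ) ^ 2 ≤ e / d := by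
      rw [div_le_div_iff₀ (by positivity) hd0]; nlinarith
    have e3 : E = E / (d : ℝ) ^ 2 + ((d : ℝ) ^ 2 - 1) * (E / (d : ℝ) ^ 2) := by field_simp; ring
    have e4 := mul_le_mul_of_nonneg_left e2 hd1.le
    linarith
  have h4 : (1 : ℝ) - 2 / (d : ℝ) ^ 2 = ((d : ℝ) ^ 2 - 2) / (d : ℝ) ^ 2 := by field_simp
  have h5 : 0 < ((d : ℝ) ^ 2 - 2) / (d : ℝ) ^ 2 := by positivity
  rw [h4, le_div_iff₀ h5]
  have h6 : ((d : ℝ) ^ 2 - e / d - e' / d + E) / ((d : ℝ) ^ 2 * ((d : ℝ) ^ 2 - 1)) ≤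
      ((d : ℝ) ^ 2 + ((d : ℝ) ^ 2 - 2) * (e / d)) / ((d : ℝ) ^ 2 * ((d : ℝ) ^ 2 - 1)) := by
    apply div_le_div_of_nonneg_right _ (by positivity)
    linarith
  have h7 : ((d : ℝ) ^ 3 - e) / (d * ((d : ℝ) ^ 2 - 1)) * (((d : ℝ) ^ 2 - 2) / (d : ℝ) ^ 2) =
      1 - ((d : ℝ) ^ 2 + ((d : ℝ) ^ 2 - 2) * (e / d)) / ((d : ℝ) ^ 2 * ((d : ℝ) ^ 2 - 1)) := by
    field_simp
    ring
  linarith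

/-- The tangent lines of the trade-off curve bound all generalized 2-instruments. -/
theorem tradeoff_le {d : ℕ} (hd : 2 ≤ d) {R : SU d → Matrix (Wires d) (Wires d) ℂ}
    (h : IsInstrument R) {x y : ℝ} (hx : 0 ≤ x) (hy : 0 ≤ y) :
    d * x * y ≤ y * (d * x + y) * disturbance R + x * (d * y + x) * (1 - information R) := by
  have hd2 : (2 : ℝ) ≤ d := by exact_mod_cast hd
  have hd0 : (0 : ℝ) < d := by linarith
  have hd1 : 0 < (d : ℝ) ^ 2 - 1 := by nlinarith
  have hi0 : Integrable (fun V => (R V).trace.re) (haarSU d) :=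
    (integrable_finsetSum _ fun a _ => h.integrable a a :
      Integrable (fun V => (R V).trace) (haarSU d)).re
  have hi1 : Integrable (fun V => (R V * bell32 d).trace.re) (haarSU d) :=
    (integrable_trace (K := fun _ => bell32 d) fun a b => (h.integrable a b).mul_const _).re
  have hi2 : Integrable (fun V => (R V * choi21 V).trace.re) (haarSU d) :=
    (integrable_trace fun a b =>
      integrable_mul_continuous (h.integrable a b) (continuous_choi21_apply b a)).re
  -- the operator inequality for each outcome, integrated over the outcomes
  have hint := integral_mono ((hi1.const_mul (y * (d * x + y))).add
      (hi2.const_mul (x * (d * y + x)))) (hi0.const_mul ((d * x + y) * (d * y + x)))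
    fun V => re_trace_two_projections_le hd0 (bell32_conjTranspose d) (choi21_conjTranspose V)
      (by simpa using bell32_mul_self d) (by simpa using choi21_mul_self V)
      (bell32_mul_choi21_mul_bell32 V) (h.posSemidef V) hx hy
  have htr : ∫ V, (R V).trace.re ∂(haarSU d) = (d : ℝ) ^ 2 := by
    rw [← h.re_trace_eq]
    simpa using integral_re_trace_mul_const h.integrable 1
  simp only [Pi.add_apply] at hint
  rw [integral_add (hi1.const_mul _) (hi2.const_mul _), integral_const_mul, integral_const_mul,
    integral_const_mul, integral_re_trace_mul_const h.integrable, htr] at hint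
  have hD := mul_le_mul_of_nonneg_left (le_disturbance hd h)
    (by positivity : 0 ≤ y * (d * x + y))
  rw [information_eq hd h]
  set e := (integralSU R * bell32 d).trace.re
  set q := ∫ V, (R V * choi21 V).trace.re ∂(haarSU d)
  have key : d * x * y ≤ y * (d * x + y) * (((d : ℝ) ^ 3 - e) / (d * ((d : ℝ) ^ 2 - 1))) +
      x * (d * y + x) * (((d : ℝ) ^ 3 - q) / (d * ((d : ℝ) ^ 2 - 1))) := by
    rw [← mul_div_assoc, ← mul_div_assoc, ← add_div, le_div_iff₀ (by positivity)]
    linarith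
  linarith

/-! ### The instruments on the curve -/

/-- The vector `|U⟩⟩₃₀ |U*⟩⟩₂₁`. -/
def pairVec {d : ℕ} (U : SU d) : Wires d → ℂ := fun a =>
  U.1 a.1 a.2.2.2 * star (U.1 a.2.1 a.2.2.1)

/-- The vector `|I⟩⟩₃₂ |I⟩⟩₁₀`. -/
def bellVec (d : ℕ) : Wires d → ℂ := fun a =>
  (1 : Matrix (Fin d) (Fin d) ℂ) a.1 a.2.1 * (1 : Matrix (Fin d) (Fin d) ℂ) a.2.2.1 a.2.2.2

theorem chi_eq {d : ℕ} (x y : ℝ) (V : SU d) :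
    chi x y V = (x : ℂ) • pairVec V + (y : ℂ) • bellVec d := rfl

theorem star_bellVec (d : ℕ) : star (bellVec d) = bellVec d := by
  funext a
  simp only [bellVec, Pi.star_apply, Matrix.one_apply]
  split_ifs <;> simp

theorem bell32_mulVec_pairVec {d : ℕ} (V : SU d) : (bell32 d).mulVec (pairVec V) = bellVec d := by
  funext a
  have h : ∑ k, V.1 k a.2.2.2 * star (V.1 k a.2.2.1) =
      if a.2.2.1 = a.2.2.2 then 1 else 0 := by
    rw [← sum_star_mul_SU V]
    exact Finset.sum_congr rfl fun x _ => mul_comm _ _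
  simp only [Complex.star_def] at h
  simp only [bell32, bellVec, pairVec, Matrix.mulVec, dotProduct, Matrix.of_apply,
    Matrix.one_apply, Fintype.sum_prod_type]
  simp [h]
  split_ifs <;> rfl

theorem bell32_mulVec_bellVec (d : ℕ) : (bell32 d).mulVec (bellVec d) = (d : ℂ) • bellVec d := by
  funext a
  simp only [bell32, bellVec, Matrix.mulVec, dotProduct, Matrix.of_apply,
    Matrix.one_apply, Fintype.sum_prod_type, Pi.smul_apply]
  simp

theorem bell10_mulVec_pairVec {d : ℕ} (V : SU d) : (bell10 d).mulVec (pairVec V) = bellVec d := by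
  funext a
  have h := sum_mul_star_SU V a.1 a.2.1
  simp only [Complex.star_def] at h
  simp only [bell10, bellVec, pairVec, Matrix.mulVec, dotProduct, Matrix.of_apply,
    Matrix.one_apply, Fintype.sum_prod_type]
  simp [h]

theorem bell10_mulVec_bellVec (d : ℕ) : (bell10 d).mulVec (bellVec d) = (d : ℂ) • bellVec d := by
  funext a
  simp only [bell10, bellVec, Matrix.mulVec, dotProduct, Matrix.of_apply,
    Matrix.one_apply, Fintype.sum_prod_type, Pi.smul_apply]
  simp
  try split_ifs <;> simp

theorem choi21_mulVec_pairVec {d : ℕ} (V : SU d) :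
    (choi21 V).mulVec (pairVec V) = (d : ℂ) • pairVec V := by
  funext a
  have h : ∑ i, ∑ j, V.1 i j * star (V.1 a.2.1 a.2.2.1) *
      (V.1 a.1 a.2.2.2 * star (V.1 i j)) =
      d * (V.1 a.1 a.2.2.2 * star (V.1 a.2.1 a.2.2.1)) := by
    rw [← sum_sum_mul_star_SU V, Finset.sum_mul]
    refine Finset.sum_congr rfl fun x _ => ?_
    rw [Finset.sum_mul]
    exact Finset.sum_congr rfl fun y _ => by ring
  simp only [Complex.star_def] at h
  simp only [choi21, pairVec, Matrix.mulVec, dotProduct, Matrix.of_apply,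
    Matrix.one_apply, Fintype.sum_prod_type, Pi.smul_apply]
  simp [h]

theorem choi21_mulVec_bellVec {d : ℕ} (V : SU d) :
    (choi21 V).mulVec (bellVec d) = pairVec V := by
  funext a
  simp only [choi21, pairVec, bellVec, Matrix.mulVec, dotProduct, Matrix.of_apply,
    Matrix.one_apply, Fintype.sum_prod_type]
  simp

theorem star_pairVec_dotProduct_pairVec {d : ℕ} (V : SU d) :
    star (pairVec V) ⬝ᵥ pairVec V = (d : ℂ) ^ 2 := by
  have h := sum_sum_mul_star_SU V
  rw [← Fintype.sum_prod_type' fun i j => V.1 i j * star (V.1 i j)] at h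
  simp only [dotProduct, sum_wires, pairVec, Pi.star_apply, star_mul', star_star]
  rw [sq, ← h, Finset.sum_mul_sum]
  exact Finset.sum_congr rfl fun a _ => Finset.sum_congr rfl fun s _ => by ring

theorem star_bellVec_dotProduct_bellVec (d : ℕ) :
    star (bellVec d) ⬝ᵥ bellVec d = (d : ℂ) ^ 2 := by
  rw [star_bellVec]
  simp [dotProduct, bellVec, Fintype.sum_prod_type, Matrix.one_apply, sq]

theorem star_bellVec_dotProduct_pairVec {d : ℕ} (V : SU d) :
    star (bellVec d) ⬝ᵥ pairVec V = (d : ℂ) := by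
  have h := sum_sum_mul_star_SU V
  simp only [Complex.star_def] at h
  rw [star_bellVec]
  simp [dotProduct, bellVec, pairVec, Fintype.sum_prod_type, Matrix.one_apply, h]

theorem star_pairVec_dotProduct_bellVec {d : ℕ} (V : SU d) :
    star (pairVec V) ⬝ᵥ bellVec d = (d : ℂ) := by
  rw [Matrix.star_dotProduct, star_bellVec_dotProduct_pairVec]
  simp

theorem trace_chiInstrument_mul {d : ℕ} (x y : ℝ) (V : SU d) (M : Matrix (Wires d) (Wires d) ℂ) :
    (chiInstrument d x y V * M).trace = star (chi x y V) ⬝ᵥ M.mulVec (chi x y V) := by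
  rw [chiInstrument, Matrix.vecMulVec_mul, Matrix.trace_vecMulVec, dotProduct_comm,
    ← Matrix.dotProduct_mulVec]

theorem re_trace_chiInstrument_mul_choi21 {d : ℕ} (x y : ℝ) (V : SU d) :
    (chiInstrument d x y V * choi21 V).trace.re = d * (x * d + y) ^ 2 := by
  rw [trace_chiInstrument_mul, chi_eq]
  simp only [Matrix.mulVec_add, Matrix.mulVec_smul, choi21_mulVec_pairVec, choi21_mulVec_bellVec,
    star_add, star_smul, dotProduct_add, add_dotProduct, smul_dotProduct, dotProduct_smul,
    star_pairVec_dotProduct_pairVec, star_bellVec_dotProduct_pairVec, smul_eq_mul,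
    Complex.star_def, Complex.conj_ofReal]
  trans ((d * (x * d + y) ^ 2 : ℝ) : ℂ).re
  · congr 1
    push_cast
    ring
  · exact Complex.ofReal_re _

theorem re_trace_chiInstrument_mul_bell32 {d : ℕ} (x y : ℝ) (V : SU d) :
    (chiInstrument d x y V * bell32 d).trace.re = d * (x + y * d) ^ 2 := by
  rw [trace_chiInstrument_mul, chi_eq]
  simp only [Matrix.mulVec_add, Matrix.mulVec_smul, bell32_mulVec_pairVec, bell32_mulVec_bellVec,
    star_add, star_smul, dotProduct_add, add_dotProduct, smul_dotProduct, dotProduct_smul,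
    star_pairVec_dotProduct_bellVec, star_bellVec_dotProduct_bellVec, smul_eq_mul,
    Complex.star_def, Complex.conj_ofReal]
  trans ((d * (x + y * d) ^ 2 : ℝ) : ℂ).re
  · congr 1
    push_cast
    ring
  · exact Complex.ofReal_re _

theorem re_trace_chiInstrument_mul_bell10 {d : ℕ} (x y : ℝ) (V : SU d) :
    (chiInstrument d x y V * bell10 d).trace.re = d * (x + y * d) ^ 2 := by
  rw [trace_chiInstrument_mul, chi_eq]
  simp only [Matrix.mulVec_add, Matrix.mulVec_smul, bell10_mulVec_pairVec, bell10_mulVec_bellVec,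
    star_add, star_smul, dotProduct_add, add_dotProduct, smul_dotProduct, dotProduct_smul,
    star_pairVec_dotProduct_bellVec, star_bellVec_dotProduct_bellVec, smul_eq_mul,
    Complex.star_def, Complex.conj_ofReal]
  trans ((d * (x + y * d) ^ 2 : ℝ) : ℂ).re
  · congr 1
    push_cast
    ring
  · exact Complex.ofReal_re _

theorem re_trace_chiInstrument_mul_bell {d : ℕ} (x y : ℝ) (V : SU d) :
    (chiInstrument d x y V * (bell32 d * bell10 d)).trace.re = d ^ 2 * (x + y * d) ^ 2 := by
  rw [trace_chiInstrument_mul, chi_eq, ← Matrix.mulVec_mulVec]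
  simp only [Matrix.mulVec_add, Matrix.mulVec_smul, bell10_mulVec_pairVec, bell10_mulVec_bellVec,
    bell32_mulVec_bellVec,
    star_add, star_smul, dotProduct_add, add_dotProduct, smul_dotProduct, dotProduct_smul,
    star_pairVec_dotProduct_bellVec, star_bellVec_dotProduct_bellVec, smul_eq_mul,
    Complex.star_def, Complex.conj_ofReal]
  trans ((d ^ 2 * (x + y * d) ^ 2 : ℝ) : ℂ).re
  · congr 1
    push_cast
    ring
  · exact Complex.ofReal_re _

theorem continuous_chiInstrument_apply {d : ℕ} (x y : ℝ) (a b : Wires d) :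
    Continuous fun V : SU d => chiInstrument d x y V a b := by
  have h : ∀ a, Continuous fun V : SU d => chi x y V a := fun a =>
    (continuous_const.mul ((continuous_coe_apply _ _).mul (continuous_coe_apply _ _).star)).add
      continuous_const
  exact (h a).mul (h b).star

theorem integralSU_chiInstrument {d : ℕ} (hd : 2 ≤ d) {x y : ℝ} (hxy : Admissible d x y) :
    integralSU (chiInstrument d x y) = ((x ^ 2 : ℝ) : ℂ) • integralSU (choiPair (d := d)) +
      ((1 - x ^ 2 : ℝ) : ℂ) • (bell32 d * bell10 d) := by
  ext a b
  have hexp : ∀ V : SU d, chiInstrument d x y V a b = (x : ℂ) ^ 2 * choiPair V a b +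
      x * y * bellVec d b * (V.1 a.1 a.2.2.2 * star (V.1 a.2.1 a.2.2.1)) +
      x * y * bellVec d a * (V.1 b.2.1 b.2.2.1 * star (V.1 b.1 b.2.2.2)) +
      y ^ 2 * (bellVec d a * bellVec d b) := by
    intro V
    have hb : star (bellVec d b) = bellVec d b := congrFun (star_bellVec d) b
    simp only [chiInstrument, Matrix.vecMulVec_apply, chi_eq, Pi.star_apply, Pi.add_apply,
      Pi.smul_apply, smul_eq_mul, star_add, star_mul', hb, Complex.star_def, Complex.conj_ofReal,
      choiPair, Matrix.of_apply, pairVec, Complex.conj_conj]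
    ring
  have hc : ∀ i j k l : Fin d, Continuous fun V : SU d => V.1 i j * star (V.1 k l) := fun i j k l =>
    (continuous_coe_apply _ _).mul (continuous_coe_apply _ _).star
  have i1 : Integrable (fun V : SU d => (x : ℂ) ^ 2 * choiPair V a b) (haarSU d) :=
    integrable_of_continuous (continuous_const.mul (continuous_choiPair_apply a b))
  have i2 : Integrable (fun V : SU d => (x * y * bellVec d b : ℂ) *
      (V.1 a.1 a.2.2.2 * star (V.1 a.2.1 a.2.2.1))) (haarSU d) :=
    integrable_of_continuous (continuous_const.mul (hc _ _ _ _))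
  have i3 : Integrable (fun V : SU d => (x * y * bellVec d a : ℂ) *
      (V.1 b.2.1 b.2.2.1 * star (V.1 b.1 b.2.2.2))) (haarSU d) :=
    integrable_of_continuous (continuous_const.mul (hc _ _ _ _))
  have e1 : (if a.1 = a.2.1 ∧ a.2.2.2 = a.2.2.1 then (d : ℂ)⁻¹ else 0) =
      (d : ℂ)⁻¹ * bellVec d a := by
    simp only [bellVec, Matrix.one_apply, ite_and, eq_comm (a := a.2.2.2)]
    split_ifs <;> simp
  have e2 : (if b.2.1 = b.1 ∧ b.2.2.1 = b.2.2.2 then (d : ℂ)⁻¹ else 0) =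
      (d : ℂ)⁻¹ * bellVec d b := by
    simp only [bellVec, Matrix.one_apply, ite_and, eq_comm (a := b.2.1)]
    split_ifs <;> simp
  have e3 : (bell32 d * bell10 d) a b = bellVec d a * bellVec d b := by
    rw [bell32_mul_bell10_apply, bellVec, bellVec]; ring
  have e4 : (x : ℂ) ^ 2 + y ^ 2 + 2 * x * y * (d : ℂ)⁻¹ = 1 := by
    have := hxy.2.2
    rw [div_eq_mul_inv] at this
    have h2 := congrArg (fun r : ℝ => (r : ℂ)) this
    push_cast at h2
    exact h2
  simp only [integralSU, Matrix.of_apply, Matrix.add_apply, Matrix.smul_apply, smul_eq_mul, hexp]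
  have i12 := i1.add i2
  have i123 := i12.add i3
  simp only [Pi.add_def] at i12 i123
  rw [integral_add i123 (integrable_const _), integral_add i12 i3,
    integral_add i1 i2, integral_const_mul, integral_const_mul, integral_const_mul,
    integral_two hd, integral_two hd, e1, e2, e3]
  simp only [integral_const, probReal_univ, one_smul]
  push_cast
  linear_combination (bellVec d a * bellVec d b) * e4

theorem posSemidef_integralSU {d : ℕ} {R : SU d → Matrix (Wires d) (Wires d) ℂ}
    (hR : ∀ V, (R V).PosSemidef) (hi : ∀ a b, Integrable (fun V => R V a b) (haarSU d)) :
    (integralSU R).PosSemidef := by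
  refine Matrix.PosSemidef.of_dotProduct_mulVec_nonneg ?_ fun v => ?_
  · ext a b
    simp only [Matrix.conjTranspose_apply, integralSU, Matrix.of_apply]
    rw [Complex.star_def, ← integral_conj]
    congr 1
    funext V
    exact congrFun (congrFun (hR V).1 a) b
  · have h : star v ⬝ᵥ (integralSU R).mulVec v =
        ∫ V, star v ⬝ᵥ (R V).mulVec v ∂(haarSU d) := by
      simp only [dotProduct, Matrix.mulVec, integralSU, Matrix.of_apply]
      rw [integral_finsetSum _ fun a _ =>
        (integrable_finsetSum _ fun b _ => (hi a b).mul_const _).const_mul _]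
      refine Finset.sum_congr rfl fun a _ => ?_
      rw [integral_const_mul, integral_finsetSum _ fun b _ => (hi a b).mul_const _]
      simp only [integral_mul_const]
    rw [h]
    exact integral_nonneg fun V => (hR V).dotProduct_mulVec_nonneg v

theorem isInstrument_chiInstrument {d : ℕ} (hd : 2 ≤ d) {x y : ℝ} (hxy : Admissible d x y) :
    IsInstrument (chiInstrument d x y) := by
  have hd0 : (d : ℂ) ≠ 0 := by exact_mod_cast (by omega : d ≠ 0)
  have hd1 : (d : ℂ) ^ 2 - 1 ≠ 0 := by
    have : (1 : ℕ) < d ^ 2 := Nat.one_lt_pow (by norm_num) (by omega)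
    rw [sub_ne_zero]
    exact_mod_cast this.ne'
  have hpos : ∀ V, (chiInstrument d x y V).PosSemidef := fun V =>
    Matrix.posSemidef_vecMulVec_self_star _
  have hi : ∀ a b, Integrable (fun V => chiInstrument d x y V a b) (haarSU d) := fun a b =>
    integrable_of_continuous (continuous_chiInstrument_apply x y a b)
  have hx : x ^ 2 ≤ 1 := by
    obtain ⟨hx, hy, h⟩ := hxy
    have : 0 ≤ 2 * x * y / d := by positivity
    nlinarith
  let v : Fin d × Fin d → ℂ := dket 1
  refine ⟨hpos, hi, posSemidef_integralSU hpos hi, ((x ^ 2 / d : ℝ) : ℂ) • 1 +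
    ((1 - x ^ 2 : ℝ) : ℂ) • Matrix.vecMulVec v (star v), ?_, ?_, ?_⟩
  · refine (Matrix.PosSemidef.one.smul ?_).add
      ((Matrix.posSemidef_vecMulVec_self_star v).smul ?_)
    · exact_mod_cast (by positivity : 0 ≤ x ^ 2 / d)
    · exact_mod_cast (by linarith : 0 ≤ 1 - x ^ 2)
  · rw [integralSU_chiInstrument hd hxy, integralSU_choiPair hd]
    ext ⟨i2, i1, i0⟩ ⟨j2, j1, j0⟩
    simp only [traceFirst, Matrix.of_apply, Matrix.add_apply, Matrix.smul_apply, Matrix.sub_apply,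
      bell32_mul_bell10_apply, Matrix.kroneckerMap_apply, Matrix.vecMulVec_apply, v, dket,
      Pi.star_apply, smul_eq_mul]
    simp only [bell32, bell10, Matrix.of_apply]
    simp only [Matrix.one_apply, Prod.mk.injEq, ite_and, Finset.sum_add_distrib,
      ← Finset.mul_sum, Finset.sum_sub_distrib]
    simp
    simp only [eq_comm (a := j2) (b := i2)]
    split_ifs <;> first | (simp; done) | (field_simp; ring)
  · ext i j
    simp only [traceFirst, Matrix.of_apply, Matrix.add_apply, Matrix.smul_apply,
      Matrix.vecMulVec_apply, v, dket, Pi.star_apply, smul_eq_mul]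
    simp only [Matrix.one_apply, Prod.mk.injEq, ite_and, Finset.sum_add_distrib, ← Finset.mul_sum]
    simp
    simp only [eq_comm (a := j) (b := i)]
    split_ifs
    · field_simp
      ring
    · simp

theorem fidelity_chiInstrument {d : ℕ} (hd : 2 ≤ d) {x y : ℝ} (hxy : Admissible d x y) :
    fidelity (chiInstrument d x y) = 1 - ((d : ℝ) ^ 2 - 2) / (d : ℝ) ^ 2 * x ^ 2 := by
  have hd2 : (2 : ℝ) ≤ d := by exact_mod_cast hd
  have hd0 : (d : ℝ) ≠ 0 := by positivity
  have hd1 : (d : ℝ) ^ 2 - 1 ≠ 0 := by nlinarith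
  have h := isInstrument_chiInstrument hd hxy
  have hconst : ∀ (M : Matrix (Wires d) (Wires d) ℂ) (c : ℝ),
      (∀ V, (chiInstrument d x y V * M).trace.re = c) →
      (integralSU (chiInstrument d x y) * M).trace.re = c := by
    intro M c hM
    rw [← integral_re_trace_mul_const h.integrable]
    simp [hM]
  rw [fidelity_eq hd h.integrable, h.re_trace_eq,
    hconst _ _ (re_trace_chiInstrument_mul_bell32 x y),
    hconst _ _ (re_trace_chiInstrument_mul_bell10 x y),
    hconst _ _ (re_trace_chiInstrument_mul_bell x y)]
  have h2 : (x + y * d) ^ 2 = (d : ℝ) ^ 2 - x ^ 2 * ((d : ℝ) ^ 2 - 1) := by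
    have h2 := hxy.2.2
    field_simp at h2
    linear_combination (d : ℝ) * h2
  rw [h2]
  field_simp
  ring

theorem gain_chiInstrument {d : ℕ} (hd : 2 ≤ d) {x y : ℝ} (hxy : Admissible d x y) :
    gain (chiInstrument d x y) = (2 - y ^ 2) / (d : ℝ) ^ 2 := by
  have hd2 : (2 : ℝ) ≤ d := by exact_mod_cast hd
  have hd0 : (d : ℝ) ≠ 0 := by positivity
  have hd1 : (d : ℝ) ^ 2 - 1 ≠ 0 := by nlinarith
  have h := isInstrument_chiInstrument hd hxy
  rw [gain_eq hd h.integrable, h.re_trace_eq]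
  simp only [re_trace_chiInstrument_mul_choi21]
  simp only [integral_const, probReal_univ, one_smul]
  have h2 : (x * d + y) ^ 2 = (d : ℝ) ^ 2 - y ^ 2 * ((d : ℝ) ^ 2 - 1) := by
    have h2 := hxy.2.2
    field_simp at h2
    linear_combination (d : ℝ) * h2
  rw [h2]
  field_simp
  ring

/-! ### Optimality and the trade-off curve -/

theorem Admissible.symm {d : ℕ} {x y : ℝ} (h : Admissible d x y) : Admissible d y x :=
  ⟨h.2.1, h.1, by rw [← h.2.2]; ring⟩

/-- Equality holds in `tradeoff_le` at disturbance `x²` and information `1 - y²`. -/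
theorem Admissible.tangent_eq {d : ℕ} (hd : 2 ≤ d) {x y : ℝ} (h : Admissible d x y) :
    y * (d * x + y) * x ^ 2 + x * (d * y + x) * y ^ 2 = d * x * y := by
  have hd0 : (d : ℝ) ≠ 0 := by exact_mod_cast (by omega : d ≠ 0)
  have h2 := h.2.2
  field_simp at h2
  linear_combination x * y * h2

theorem Admissible.pos_or_pos {d : ℕ} {x y : ℝ} (h : Admissible d x y) : 0 < x ∨ 0 < y := by
  rcases h.1.eq_or_lt with hx | hx
  · rcases h.2.1.eq_or_lt with hy | hy
    · have := h.2.2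
      rw [← hx, ← hy] at this
      norm_num at this
    · exact Or.inr hy
  · exact Or.inl hx

theorem Admissible.conic {d : ℕ} (hd : 2 ≤ d) {x y : ℝ} (h : Admissible d x y) :
    (d : ℝ) ^ 2 * (x ^ 2 - (1 - y ^ 2)) ^ 2 - 4 * x ^ 2 * (1 - (1 - y ^ 2)) = 0 := by
  have hd0 : (d : ℝ) ≠ 0 := by exact_mod_cast (by omega : d ≠ 0)
  have h1 : x ^ 2 - (1 - y ^ 2) = -(2 * x * y / d) := by linarith [h.2.2]
  rw [h1]
  field_simp
  ring

theorem Admissible.sq_le {d : ℕ} {x y : ℝ} (h : Admissible d x y) : x ^ 2 ≤ 1 - y ^ 2 := by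
  obtain ⟨hx, hy, h2⟩ := h
  have : 0 ≤ 2 * x * y / d := by positivity
  linarith

theorem exists_admissible {d : ℕ} {y : ℝ} (hy : 0 ≤ y) (hy1 : y ≤ 1) :
    ∃ x, Admissible d x y := by
  have h0 : 0 ≤ (y / d) ^ 2 + (1 - y ^ 2) := by nlinarith [sq_nonneg (y / d)]
  refine ⟨√((y / d) ^ 2 + (1 - y ^ 2)) - y / d, ?_, hy, ?_⟩
  · exact sub_nonneg.2 (Real.le_sqrt_of_sq_le (by nlinarith))
  · have := Real.sq_sqrt h0
    rw [mul_assoc, mul_div_assoc, mul_div_assoc]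
    linear_combination this

theorem admissible_of_conic {d : ℕ} (hd : 2 ≤ d) {D I : ℝ} (hD : 0 ≤ D) (hI : I ≤ 1) (hDI : D ≤ I)
    (h : (d : ℝ) ^ 2 * (D - I) ^ 2 - 4 * D * (1 - I) = 0) :
    Admissible d √D √(1 - I) := by
  have hd0 : (0 : ℝ) < d := by exact_mod_cast (by omega : 0 < d)
  refine ⟨Real.sqrt_nonneg _, Real.sqrt_nonneg _, ?_⟩
  have h1 : 2 * √D * √(1 - I) = d * (I - D) := by
    rw [mul_assoc, ← Real.sqrt_mul hD]
    have h2 : (d * (I - D) / 2) ^ 2 = D * (1 - I) := by linarith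
    rw [← h2, Real.sqrt_sq (by have := sub_nonneg.2 hDI; positivity)]
    ring
  rw [Real.sq_sqrt hD, Real.sq_sqrt (sub_nonneg.2 hI), h1]
  field_simp
  ring

theorem disturbance_chiInstrument {d : ℕ} (hd : 2 ≤ d) {x y : ℝ} (hxy : Admissible d x y) :
    disturbance (chiInstrument d x y) = x ^ 2 := by
  have hd2 : (2 : ℝ) ≤ d := by exact_mod_cast hd
  have hd3 : (d : ℝ) ^ 2 - 2 ≠ 0 := by nlinarith
  rw [disturbance, fidelity_chiInstrument hd hxy]
  field_simp
  ring

theorem information_chiInstrument {d : ℕ} (hd : 2 ≤ d) {x y : ℝ} (hxy : Admissible d x y) :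
    information (chiInstrument d x y) = 1 - y ^ 2 := by
  have hd0 : (d : ℝ) ≠ 0 := by exact_mod_cast (by omega : d ≠ 0)
  rw [information, gain_chiInstrument hd hxy]
  field_simp
  ring

/-- For given information no instrument disturbs less than the admissible one. -/
theorem sq_le_disturbance {d : ℕ} (hd : 2 ≤ d) {R : SU d → Matrix (Wires d) (Wires d) ℂ}
    (hR : IsInstrument R) {x y : ℝ} (hxy : Admissible d x y) (hI : information R = 1 - y ^ 2) :
    x ^ 2 ≤ disturbance R := by
  have hd0 : (0 : ℝ) < d := by exact_mod_cast (by omega : 0 < d)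
  obtain ⟨hx, hy, h2⟩ := id hxy
  rcases hy.eq_or_lt with hy0 | hy0
  · -- the tangent is vertical here, so neighbouring tangents are used
    rw [← hy0] at hI h2
    have hx1 : x ^ 2 = 1 := by simpa using h2
    rw [hx1]
    by_contra! hlt
    have hε : 0 < d * (1 - disturbance R) := mul_pos hd0 (by linarith)
    have h3 := tradeoff_le hd hR zero_le_one hε.le
    rw [hI] at h3
    have h4 : d * (1 - disturbance R) * disturbance R < d * (1 - disturbance R) :=
      mul_lt_of_lt_one_right hε hlt
    have h5 := mul_lt_mul_of_pos_left h4 hε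
    linarith
  · have h3 := tradeoff_le hd hR hx hy
    rw [← hxy.tangent_eq hd, hI] at h3
    have h4 : 0 < y * (d * x + y) := by positivity
    have h5 : y * (d * x + y) * x ^ 2 ≤ y * (d * x + y) * disturbance R := by linarith
    exact le_of_mul_le_mul_left h5 h4

/-- For given disturbance no instrument gains more information than the admissible one. -/
theorem information_le {d : ℕ} (hd : 2 ≤ d) {R : SU d → Matrix (Wires d) (Wires d) ℂ}
    (hR : IsInstrument R) {x y : ℝ} (hxy : Admissible d x y) (hD : disturbance R = x ^ 2) :
    information R ≤ 1 - y ^ 2 := by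
  have hd0 : (0 : ℝ) < d := by exact_mod_cast (by omega : 0 < d)
  obtain ⟨hx, hy, h2⟩ := id hxy
  rcases hx.eq_or_lt with hx0 | hx0
  · -- the tangent is horizontal here, so neighbouring tangents are used
    rw [← hx0] at hD h2
    have hy1 : y ^ 2 = 1 := by simpa using h2
    rw [hy1]
    by_contra! hlt
    have hlt' : 1 - information R < 1 := by linarith
    have hε : 0 < d * information R := mul_pos hd0 (by linarith)
    have h3 := tradeoff_le hd hR hε.le zero_le_one
    rw [hD] at h3
    have h4 : d * information R * (1 - information R) < d * information R :=
      mul_lt_of_lt_one_right hε hlt'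
    have h5 := mul_lt_mul_of_pos_left h4 hε
    linarith
  · have h3 := tradeoff_le hd hR hx hy
    rw [← hxy.tangent_eq hd, hD] at h3
    have h4 : 0 < x * (d * y + x) := by positivity
    have h5 : x * (d * y + x) * y ^ 2 ≤ x * (d * y + x) * (1 - information R) := by linarith
    have := le_of_mul_le_mul_left h5 h4
    linarith

theorem merit_eq {d : ℕ} (hd : 2 ≤ d) (p : ℝ) (R : SU d → Matrix (Wires d) (Wires d) ℂ) :
    (d : ℝ) ^ 2 * merit p R = 2 * p + (1 - p) * (d : ℝ) ^ 2 -
      (p * (1 - information R) + (1 - p) * ((d : ℝ) ^ 2 - 2) * disturbance R) := by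
  have hd2 : (2 : ℝ) ≤ d := by exact_mod_cast hd
  have hd3 : (d : ℝ) ^ 2 - 2 ≠ 0 := by nlinarith
  rw [merit, information, disturbance]
  field_simp
  ring

/-- An admissible pair is optimal for the weight whose level lines are parallel to the tangent of
the trade-off curve. -/
theorem isOptimal_chiInstrument {d : ℕ} (hd : 2 ≤ d) {p x y : ℝ} (hp0 : 0 ≤ p) (hp1 : p ≤ 1)
    (hxy : Admissible d x y)
    (h : p * (y * (d * x + y)) = (1 - p) * ((d : ℝ) ^ 2 - 2) * (x * (d * y + x))) :
    IsOptimal p (chiInstrument d x y) := by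
  have hd2 : (2 : ℝ) ≤ d := by exact_mod_cast hd
  have hd3 : 0 < (d : ℝ) ^ 2 - 2 := by nlinarith
  refine ⟨isInstrument_chiInstrument hd hxy, fun S hS => ?_⟩
  obtain ⟨hx, hy, -⟩ := id hxy
  have ht := tradeoff_le hd hS hx hy
  rw [← hxy.tangent_eq hd] at ht
  have hsum : 0 < y * (d * x + y) + x * (d * y + x) := by
    rcases hxy.pos_or_pos with h0 | h0 <;> positivity
  set s := (1 - p) * ((d : ℝ) ^ 2 - 2) with hs
  have hs0 : 0 ≤ s := mul_nonneg (by linarith) hd3.le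
  have key : (y * (d * x + y) + x * (d * y + x)) * (p * y ^ 2 + s * x ^ 2) ≤
      (y * (d * x + y) + x * (d * y + x)) * (p * (1 - information S) + s * disturbance S) := by
    have h1 := mul_le_mul_of_nonneg_left ht (add_nonneg hp0 hs0)
    linear_combination h1 + (y ^ 2 - x ^ 2 - (1 - information S) + disturbance S) * h
  have h2 := le_of_mul_le_mul_left key hsum
  have h3 := merit_eq hd p S
  have h4 := merit_eq hd p (chiInstrument d x y)
  rw [disturbance_chiInstrument hd hxy, information_chiInstrument hd hxy] at h4
  have hd4 : 0 < (d : ℝ) ^ 2 := by positivity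
  refine le_of_mul_le_mul_left ?_ hd4
  rw [h3, h4]
  linarith

theorem exists_admissible_of_weight {d : ℕ} (hd : 2 ≤ d) {p : ℝ} (hp0 : 0 ≤ p) (hp1 : p ≤ 1) :
    ∃ x y : ℝ, Admissible d x y ∧
      p * (y * (d * x + y)) = (1 - p) * ((d : ℝ) ^ 2 - 2) * (x * (d * y + x)) := by
  have hd2 : (2 : ℝ) ≤ d := by exact_mod_cast hd
  have hd0 : (0 : ℝ) < d := by linarith
  have hd3 : 0 < (d : ℝ) ^ 2 - 2 := by nlinarith
  set s := (1 - p) * ((d : ℝ) ^ 2 - 2) with hs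
  have hs0 : 0 ≤ s := mul_nonneg (by linarith) hd3.le
  -- the condition is homogeneous: find a direction first, then normalize
  obtain ⟨τ, ⟨hτ0, hτ1⟩, hτ⟩ : ∃ τ ∈ Set.Icc (0 : ℝ) 1,
      p * (τ * (d * (1 - τ) + τ)) - s * ((1 - τ) * (d * τ + (1 - τ))) = 0 := by
    have hc : ContinuousOn (fun τ : ℝ => p * (τ * (d * (1 - τ) + τ)) -
        s * ((1 - τ) * (d * τ + (1 - τ)))) (Set.Icc 0 1) := by fun_prop
    exact intermediate_value_Icc zero_le_one hc ⟨by simpa using hs0, by simpa using hp0⟩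
  set r := √((1 - τ) ^ 2 + τ ^ 2 + 2 * (1 - τ) * τ / d) with hr
  have hpos : 0 < (1 - τ) ^ 2 + τ ^ 2 + 2 * (1 - τ) * τ / d := by
    have h1 : 0 ≤ 1 - τ := by linarith
    have : 0 ≤ 2 * (1 - τ) * τ / d := by positivity
    nlinarith [sq_nonneg (1 - 2 * τ)]
  have hr0 : 0 < r := Real.sqrt_pos.2 hpos
  have hr2 : r ^ 2 = (1 - τ) ^ 2 + τ ^ 2 + 2 * (1 - τ) * τ / d := Real.sq_sqrt hpos.le
  refine ⟨(1 - τ) / r, τ / r, ⟨div_nonneg (by linarith) hr0.le, div_nonneg hτ0 hr0.le, ?_⟩, ?_⟩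
  · have : ((1 - τ) / r) ^ 2 + (τ / r) ^ 2 + 2 * ((1 - τ) / r) * (τ / r) / d =
        ((1 - τ) ^ 2 + τ ^ 2 + 2 * (1 - τ) * τ / d) / r ^ 2 := by field_simp
    rw [this, ← hr2, div_self (by positivity)]
  · have h1 : p * (τ / r * (d * ((1 - τ) / r) + τ / r)) =
        p * (τ * (d * (1 - τ) + τ)) / r ^ 2 := by field_simp
    have h2 : s * ((1 - τ) / r * (d * (τ / r) + (1 - τ) / r)) =
        s * ((1 - τ) * (d * τ + (1 - τ))) / r ^ 2 := by field_simp
    rw [h1, h2, sub_eq_zero.1 hτ]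

theorem exists_weight_of_admissible {d : ℕ} (hd : 2 ≤ d) {x y : ℝ} (hxy : Admissible d x y) :
    ∃ p : ℝ, 0 ≤ p ∧ p ≤ 1 ∧
      p * (y * (d * x + y)) = (1 - p) * ((d : ℝ) ^ 2 - 2) * (x * (d * y + x)) := by
  have hd2 : (2 : ℝ) ≤ d := by exact_mod_cast hd
  have hd3 : 0 < (d : ℝ) ^ 2 - 2 := by nlinarith
  obtain ⟨hx, hy, -⟩ := id hxy
  have hsum : 0 < y * (d * x + y) + ((d : ℝ) ^ 2 - 2) * (x * (d * y + x)) := by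
    rcases hxy.pos_or_pos with h0 | h0 <;> positivity
  refine ⟨((d : ℝ) ^ 2 - 2) * (x * (d * y + x)) /
    (y * (d * x + y) + ((d : ℝ) ^ 2 - 2) * (x * (d * y + x))), by positivity, ?_, ?_⟩
  · rw [div_le_one hsum]
    have : 0 ≤ y * (d * x + y) := by positivity
    linarith
  · rw [one_sub_div hsum.ne']
    ring

theorem isLeast_disturbance {d : ℕ} (hd : 2 ≤ d) {x y : ℝ} (hxy : Admissible d x y) :
    IsLeast {t : ℝ | ∃ R : SU d → Matrix (Wires d) (Wires d) ℂ,
      IsInstrument R ∧ information R = 1 - y ^ 2 ∧ disturbance R = t} (x ^ 2) := by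
  refine ⟨⟨_, isInstrument_chiInstrument hd hxy, information_chiInstrument hd hxy,
    disturbance_chiInstrument hd hxy⟩, ?_⟩
  rintro t ⟨R, hR, hI, rfl⟩
  exact sq_le_disturbance hd hR hxy hI

theorem isGreatest_information {d : ℕ} (hd : 2 ≤ d) {x y : ℝ} (hxy : Admissible d x y) :
    IsGreatest {t : ℝ | ∃ R : SU d → Matrix (Wires d) (Wires d) ℂ,
      IsInstrument R ∧ disturbance R = x ^ 2 ∧ information R = t} (1 - y ^ 2) := by
  refine ⟨⟨_, isInstrument_chiInstrument hd hxy, disturbance_chiInstrument hd hxy,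
    information_chiInstrument hd hxy⟩, ?_⟩
  rintro t ⟨R, hR, hD, rfl⟩
  exact information_le hd hR hxy hD

end QTradeoff

end

theorem mainTheorem1 (d : ℕ) (hd : 2 ≤ d) :
    -- for each weight an admissible instrument is optimal among all generalized 2-instruments
    (∀ p : ℝ, 0 ≤ p → p ≤ 1 → ∃ x y : ℝ, QTradeoff.Admissible d x y ∧
      QTradeoff.IsOptimal p (QTradeoff.chiInstrument d x y)) ∧
    -- values along the curve; each of its points is optimal for some weight
    (∀ x y : ℝ, QTradeoff.Admissible d x y →
      QTradeoff.IsInstrument (QTradeoff.chiInstrument d x y) ∧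
      QTradeoff.fidelity (QTradeoff.chiInstrument d x y)
        = 1 - ((d : ℝ) ^ 2 - 2) / (d : ℝ) ^ 2 * x ^ 2 ∧
      QTradeoff.gain (QTradeoff.chiInstrument d x y) = (2 - y ^ 2) / (d : ℝ) ^ 2 ∧
      x = √(QTradeoff.disturbance (QTradeoff.chiInstrument d x y)) ∧
      y = √(1 - QTradeoff.information (QTradeoff.chiInstrument d x y)) ∧
      (d : ℝ) ^ 2 * (QTradeoff.disturbance (QTradeoff.chiInstrument d x y)
          - QTradeoff.information (QTradeoff.chiInstrument d x y)) ^ 2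
        - 4 * QTradeoff.disturbance (QTradeoff.chiInstrument d x y)
          * (1 - QTradeoff.information (QTradeoff.chiInstrument d x y)) = 0 ∧
      ∃ p : ℝ, 0 ≤ p ∧ p ≤ 1 ∧ QTradeoff.IsOptimal p (QTradeoff.chiInstrument d x y)) ∧
    -- minimum disturbance for a given amount of information
    (∀ I D : ℝ, 0 ≤ I → I ≤ 1 →
      (IsLeast {t : ℝ | ∃ R : QTradeoff.SU d →
            Matrix (QTradeoff.Wires d) (QTradeoff.Wires d) ℂ,
          QTradeoff.IsInstrument R ∧ QTradeoff.information R = I ∧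
            QTradeoff.disturbance R = t} D ↔
        D ≤ I ∧ (d : ℝ) ^ 2 * (D - I) ^ 2 - 4 * D * (1 - I) = 0)) ∧
    -- maximum information for a given disturbance
    (∀ D I : ℝ, 0 ≤ D → D ≤ 1 →
      (IsGreatest {t : ℝ | ∃ R : QTradeoff.SU d →
            Matrix (QTradeoff.Wires d) (QTradeoff.Wires d) ℂ,
          QTradeoff.IsInstrument R ∧ QTradeoff.disturbance R = D ∧
            QTradeoff.information R = t} I ↔
        D ≤ I ∧ (d : ℝ) ^ 2 * (D - I) ^ 2 - 4 * D * (1 - I) = 0)) := by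
  have hd2 : (2 : ℝ) ≤ d := by exact_mod_cast hd
  have hd4 : 0 < (d : ℝ) ^ 2 := by positivity
  refine ⟨fun p hp0 hp1 => ?_, fun x y hxy => ?_, fun I D hI0 hI1 => ⟨fun h => ?_, ?_⟩,
    fun D I hD0 hD1 => ⟨fun h => ?_, ?_⟩⟩
  · obtain ⟨x, y, hxy, h⟩ := QTradeoff.exists_admissible_of_weight hd hp0 hp1
    exact ⟨x, y, hxy, QTradeoff.isOptimal_chiInstrument hd hp0 hp1 hxy h⟩
  · obtain ⟨p, hp0, hp1, h⟩ := QTradeoff.exists_weight_of_admissible hd hxy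
    refine ⟨QTradeoff.isInstrument_chiInstrument hd hxy, QTradeoff.fidelity_chiInstrument hd hxy,
      QTradeoff.gain_chiInstrument hd hxy, ?_, ?_, ?_, p, hp0, hp1,
      QTradeoff.isOptimal_chiInstrument hd hp0 hp1 hxy h⟩
    · rw [QTradeoff.disturbance_chiInstrument hd hxy, Real.sqrt_sq hxy.1]
    · rw [QTradeoff.information_chiInstrument hd hxy, sub_sub_cancel, Real.sqrt_sq hxy.2.1]
    · rw [QTradeoff.disturbance_chiInstrument hd hxy, QTradeoff.information_chiInstrument hd hxy]
      exact hxy.conic hd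
  · have hy2 : √(1 - I) ^ 2 = 1 - I := Real.sq_sqrt (by linarith)
    obtain ⟨x, hxy⟩ := QTradeoff.exists_admissible (d := d) (Real.sqrt_nonneg (1 - I))
      (Real.sqrt_le_one.2 (by linarith))
    have hI : 1 - √(1 - I) ^ 2 = I := by rw [hy2]; ring
    have hl := QTradeoff.isLeast_disturbance hd hxy
    rw [hI] at hl
    rw [h.unique hl]
    have h1 := hxy.sq_le
    have h2 := hxy.conic hd
    rw [hI] at h1 h2
    exact ⟨h1, h2⟩
  · rintro ⟨hDI, h⟩
    have hD0 : 0 ≤ D := by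
      by_contra! hneg
      have h1 : 0 < (d : ℝ) ^ 2 * (D - I) ^ 2 :=
        mul_pos hd4 (sq_pos_of_neg (by linarith))
      nlinarith [mul_nonneg (neg_nonneg.2 hneg.le) (sub_nonneg.2 hI1)]
    have hl := QTradeoff.isLeast_disturbance hd
      (QTradeoff.admissible_of_conic hd hD0 hI1 hDI h)
    rwa [Real.sq_sqrt hD0, Real.sq_sqrt (sub_nonneg.2 hI1), sub_sub_cancel] at hl
  · obtain ⟨y, hyx⟩ := QTradeoff.exists_admissible (d := d) (Real.sqrt_nonneg D)
      (Real.sqrt_le_one.2 hD1)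
    have hxy := hyx.symm
    have hD : √D ^ 2 = D := Real.sq_sqrt hD0
    have hl := QTradeoff.isGreatest_information hd hxy
    rw [hD] at hl
    rw [h.unique hl]
    have h1 := hxy.sq_le
    have h2 := hxy.conic hd
    rw [hD] at h1 h2
    exact ⟨h1, h2⟩
  · rintro ⟨hDI, h⟩
    have hI1 : I ≤ 1 := by
      by_contra! hgt
      have h1 : 0 < (d : ℝ) ^ 2 * (D - I) ^ 2 :=
        mul_pos hd4 (sq_pos_of_neg (by linarith))
      nlinarith [mul_nonneg hD0 (sub_nonneg.2 hgt.le)]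
    have hl := QTradeoff.isGreatest_information hd
      (QTradeoff.admissible_of_conic hd hD0 hI1 hDI h)
    rwa [Real.sq_sqrt hD0, Real.sq_sqrt (sub_nonneg.2 hI1), sub_sub_cancel] at hl
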